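/- **Non-recursive formula for the diagonal Seeley–DeWitt coefficients.** Let $d\ge 1$, $m\ge 0$, let $\Omega\subset\mathbb R^d$ be open and convex, let $B_1,\dots,B_d$ and $v$ be smooth functions on $\Omega$ with values in the $m\times m$ real or complex matrices (for instance, the $B_\mu$ may take values in the Lie algebra of a compact matrix group). Put $$D_\mu=\partial_\mu+B_\mu,\qquad A=-\sum_{\mu}D_\mu D_\mu-v,\qquad \nabla_\mu f=\partial_\mu f+[B_\mu,f],\qquad F_{\mu\nu}=[D_\mu,D_\nu]=\partial_\mu B_\nu-\partial_\nu B_\mu+[B_\mu,B_\nu].$$ Let $\hat a_n(x,y)$, $n\ge 0$, $x,y\in\Omega$, be the coefficients of the ansatz $(4\pi\tau)^{-d/2}e^{-|x-y|^2/(4\tau)}\sum_{n\ge0}\tau^n\hat a_n(x,y)$ for the heat equation $(\partial_\tau+A)K=0$, i.e. matrix functions, smooth in $x\in\Omega$ for each $y\in\Omega$, with $$\sum_\mu(x-y)^\mu D_{x^\mu}\hat a_0(x,y)=0,\quad \hat a_0(x,x)=1,\qquad \Bigl(n+\sum_\mu(x-y)^\mu D_{x^\mu}\Bigr)\hat a_n(x,y)=-A(x)\hat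 a_{n-1}(x,y)\quad(n>0).$$ *Tensors.* For labels $i_k\ge\dots\ge i_2\ge i_1>0$ with indices $\mu_{i_j}\in\{1,\dots,d\}$, where no two labels coincide except possibly for pairs, define $\tilde\Omega^{\mu_{i_k}\dots\mu_{i_1}}$ at the point $x$ as follows. Round brackets denote symmetrization (the mean over all permutations of the enclosed indices, an index between bars $|\cdot|$ being left out). The empty tensor ($k=0$) is $1$, and $\tilde\Omega^{\mu_i}=0$. If $k\ge2$ and $i_2>i_1$, then $$\tilde\Omega^{\mu_{i_k}\dots\mu_{i_1}}=\frac{2(k-1)}{k}\nabla_{(\mu_{i_k}}\cdots\nabla_{\mu_{i_3}}F_{\mu_{i_2})\mu_{i_1}}(x).$$ If $i_2=i_1$, then $\tilde\Omega^{\mu_{i_2}\mu_{i_1}}=v(x)$ for $k=2$, and for $k\ge3$, where the index $c=\mu_{i_1}$ is summed from $1$ to $d$ inside the tensor, $$\tilde\Omega^{\mu_{i_k}\dots\mu_{i_1}}=\frac{k-1}{k}\sum_{c}\nabla_{(\mu_{i_k}}\cdots\nabla_{\mu_{i_3}}F_{c)c}(x)+\nabla_{(\mu_{i_k}}\cdots\nabla_{\mu_{i_3})}v(x)$$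 $$\qquad+\sum_{r=0}^{k-4}\frac{(r+1)(k-r-3)(k-2)!}{(r+2)!\,(k-r-2)!}\sum_{c}\nabla_{(\mu_{i_k}}\cdots\nabla_{\mu_{i_{r+5}}}F_{\mu_{i_{r+4}}|c|}(x)\,\nabla_{\mu_{i_{r+3}}}\cdots\nabla_{\mu_{i_4}}F_{\mu_{i_3})c}(x)$$ (for $k=3$ the last sum is empty). *Families.* Let $\boldsymbol\sigma_n$ be the set of all families $(\sigma_1,\dots,\sigma_n)$ of sets $\sigma_i=\{\sigma_i(p_i),\dots,\sigma_i(1)\}$, $p_i=\#\sigma_i$, such that for all $i\in\{1,\dots,n\}$: (1) $\sigma_i(k)>\sigma_i(j)$ for $p_i\ge k>j\ge1$; (2) $\bigcup_{j=1}^n\sigma_j=\{1,\dots,2n\}$; (3) $\sigma_i\subset\{2i-1,\dots,2n\}\setminus\bigcup_{j=i+1}^n\sigma_j$; (4) either $2i-1\in\sigma_i$ or $\sigma_i=\emptyset$. Write $\mu_{\sigma_i}=\mu_{\sigma_i(p_i)}\dots\mu_{\sigma_i(1)}$. **Theorem.** For all $n\ge0$ and $x\in\Omega$, $$\hat a_n(x,x)=\left.\sum_{(\sigma_1,\dots,\sigma_n)\in\boldsymbol\sigma_n}\frac{\tilde\Omega^{\mu_{\sigma_n}}}{p_1+\dots+p_n-n}\cdots\frac{\tilde\Omega^{\mu_{\sigma_2}}}{p_1+p_2-2}\,\frac{\tilde\Omega^{\mu_{\sigma_1}}}{p_1-1}\right|_{\mu_{2j-1}=\mu_{2j}\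 \forall j},$$ where the bar means that for every $j$ the labels $2j-1$ and $2j$ and their indices are identified and the common index is summed once from $1$ to $d$; if $2j-1,2j\in\sigma_j$, this summation is the one already contained in $\tilde\Omega^{\mu_{\sigma_j}}$, and no further sum over $\mu_{2j}$ is taken. -/

import Mathlib

open scoped ContDiff

/-- `EuclideanSpace ℝ (Fin d)`, the space `ℝ^d`. -/
abbrev Eucl (d : ℕ) : Type := EuclideanSpace ℝ (Fin d)

namespace SeeleyDeWitt

noncomputable section

variable {d : ℕ} {R : Type*} [NormedRing R] [NormedAlgebra ℝ R]

/-- The partial derivative `∂_μ f`. -/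
def pd (μ : Fin d) (f : Eucl d → R) (x : Eucl d) : R :=
  fderiv ℝ f x (EuclideanSpace.single μ 1)

/-- The covariant derivative `D_μ f = ∂_μ f + B_μ f`. -/
def covD (B : Fin d → Eucl d → R) (μ : Fin d) (f : Eucl d → R) (x : Eucl d) : R :=
  pd μ f x + B μ x * f x

/-- The Laplace-type operator `A f = - D_μ D_μ f - v f`. -/
def laplaceOp (B : Fin d → Eucl d → R) (v : Eucl d → R) (f : Eucl d → R) (x : Eucl d) : R :=
  -(∑ μ, covD B μ (covD B μ f) x) - v x * f x

/-- The derivative `(x - y)^μ D_μ f` at `x`. -/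
def radialD (B : Fin d → Eucl d → R) (y : Eucl d) (f : Eucl d → R) (x : Eucl d) : R :=
  ∑ μ, (x μ - y μ) • covD B μ f x

/-- `a n x y` are the coefficients of the heat kernel ansatz
`(4πτ)^{-d/2} exp(-|x-y|²/(4τ)) ∑ τ^n a_n(x,y)` for the operator `laplaceOp B v` on `Ω`: they are
smooth in `x` and solve the recurrence system that this ansatz turns the heat equation into. -/
structure IsHeatCoeff (Ω : Set (Eucl d)) (B : Fin d → Eucl d → R) (v : Eucl d → R)
    (a : ℕ → Eucl d → Eucl d → R) : Prop where
  smooth : ∀ n, ∀ y ∈ Ω, ContDiffOn ℝ ∞ (fun x => a n x y) Ω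
  diag_zero : ∀ x ∈ Ω, a 0 x x = 1
  transport : ∀ x ∈ Ω, ∀ y ∈ Ω, radialD B y (fun z => a 0 z y) x = 0
  recurrence : ∀ n : ℕ, 0 < n → ∀ x ∈ Ω, ∀ y ∈ Ω,
    (n : ℝ) • a n x y + radialD B y (fun z => a n z y) x
      = -laplaceOp B v (fun z => a (n - 1) z y) x

/-- `∇_μ f = ∂_μ f + [B_μ, f]`. -/
def nabla (B : Fin d → Eucl d → R) (μ : Fin d) (f : Eucl d → R) (x : Eucl d) : R :=
  pd μ f x + (B μ x * f x - f x * B μ x)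

/-- The curvature `F_{μν} = [D_μ, D_ν] = ∂_μ B_ν - ∂_ν B_μ + [B_μ, B_ν]`. -/
def curv (B : Fin d → Eucl d → R) (μ ν : Fin d) (x : Eucl d) : R :=
  pd μ (B ν) x - pd ν (B μ) x + (B μ x * B ν x - B ν x * B μ x)

/-- `∇_{α₁} ⋯ ∇_{α_r} f` for a list `α = [α₁, …, α_r]`. -/
def nablas (B : Fin d → Eucl d → R) (f : Eucl d → R) : List (Fin d) → Eucl d → R
  | [] => f
  | μ :: α => nabla B μ (nablas B f α)

/-- `∇_{α₁} ⋯ ∇_{α_{r-1}} F_{α_r c}` for a list `α = [α₁, …, α_r]` with `r ≥ 1`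
(the value `0` for the empty list is never used). -/
def nablasF (B : Fin d → Eucl d → R) (c : Fin d) : List (Fin d) → Eucl d → R
  | [] => 0
  | [μ] => curv B μ c
  | μ :: ν :: α => nabla B μ (nablasF B c (ν :: α))

/-- Symmetrization: the mean of the tensor `T` over all permutations of the places of `α`. -/
def symm (T : List (Fin d) → R) (α : List (Fin d)) : R :=
  ((α.length.factorial : ℝ)⁻¹) •
    ∑ π : Equiv.Perm (Fin α.length), T (List.ofFn fun s => α.get (π s))

/-- The tensor `Ω̃` with smallest label `i₁` different from the next one:
for `α = [μ_{i_k}, …, μ_{i_2}]` and `c = μ_{i_1}` it is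
`(2(k-1)/k) ∇_{(μ_{i_k}} ⋯ ∇_{μ_{i_3}} F_{μ_{i_2}) μ_{i_1}}`. -/
def omegaOff (B : Fin d → Eucl d → R) (α : List (Fin d)) (c : Fin d) (x : Eucl d) : R :=
  (2 * (α.length : ℝ) / (α.length + 1)) • symm (fun β => nablasF B c β x) α

/-- The tensor `Ω̃` with equal smallest labels `i₁ = i₂`, as a function of
`α = [μ_{i_k}, …, μ_{i_3}]`. The repeated index `c = μ_{i_1}` is summed over.
For `k = 2` it is `v`; for `k = 3` the last sum is empty. -/
def omegaDiag (B : Fin d → Eucl d → R) (v : Eucl d → R) (α : List (Fin d)) (x : Eucl d) : R :=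
  let k : ℕ := α.length + 2
  if α = [] then v x else
    (((k : ℝ) - 1) / k) • ∑ c, symm (fun β => nablasF B c β x) (α ++ [c])
    + symm (fun β => nablas B v β x) α
    + ∑ n ∈ Finset.range (k - 3),
        ((((n : ℝ) + 1) * ((k : ℝ) - n - 3) * (k - 2).factorial)
            / ((n + 2).factorial * (k - n - 2).factorial)) •
          ∑ c, symm (fun β =>
            nablasF B c (β.take (k - n - 3)) x * nablasF B c (β.drop (k - n - 3)) x) α

/-- The tensor `Ω̃^{μ_{i_k} … μ_{i_1}}`. An index is a pair (label `i`, value `μ_i`), and the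
argument lists the indices by increasing label, `[(i₁, μ_{i_1}), (i₂, μ_{i_2}), …]`. -/
def omega (B : Fin d → Eucl d → R) (v : Eucl d → R) :
    List (ℕ × Fin d) → Eucl d → R
  | [], _ => 1
  | [_], _ => 0
  | p :: q :: l, x =>
      if p.1 = q.1 then omegaDiag B v (l.map Prod.snd).reverse x
      else omegaOff B ((q :: l).map Prod.snd).reverse p.2 x

/-- The families `(σ_1, …, σ_n)`, with all labels shifted by one: the member `i : Fin n` stands
for `σ_{i+1}`, and `q : Fin (2 * n)` stands for `q + 1 ∈ {1, …, 2n}`. The sets are unordered;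
the listing of their elements by size is done by `Finset.sort` below. -/
def families (n : ℕ) : Finset (Fin n → Finset (Fin (2 * n))) :=
  Finset.univ.filter fun σ =>
    (∀ q, ∃ i, q ∈ σ i)
    ∧ (∀ i, ∀ q ∈ σ i, 2 * (i : ℕ) ≤ q ∧ ∀ j, i < j → q ∉ σ j)
    ∧ (∀ i, (∃ q ∈ σ i, (q : ℕ) = 2 * i) ∨ σ i = ∅)

/-- The pair `{2j-1, 2j}` is contracted inside the tensor of `σ_j`, i.e. `2j ∈ σ_j`
(for the families above `2j-1` is then in `σ_j` as well). -/
def IsInner {n : ℕ} (σ : Fin n → Finset (Fin (2 * n))) (j : Fin n) : Prop :=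
  ∃ q ∈ σ j, (q : ℕ) = 2 * j + 1

open Classical in
/-- The values of the summation indices: `ν j` is the common value of `μ_{2j-1} = μ_{2j}`.
For a pair contracted inside its own tensor the sum is already part of that tensor, which does
not depend on `ν j`; such a `ν j` is pinned to one value, so that no further sum is taken. -/
def indexValues [NeZero d] {n : ℕ} (σ : Fin n → Finset (Fin (2 * n))) :
    Finset (Fin n → Fin d) :=
  Finset.univ.filter fun ν => ∀ j, IsInner σ j → ν j = 0

/-- The index list `μ_{σ_i}` after the identification of the indices `2j-1` and `2j`. -/
def indexList {n : ℕ} (s : Finset (Fin (2 * n))) (ν : Fin n → Fin d) : List (ℕ × Fin d) :=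
  (s.sort (· ≤ ·)).map fun q : Fin (2 * n) => ((q : ℕ) / 2, ν ⟨(q : ℕ) / 2, Nat.div_lt_of_lt_mul q.isLt⟩)

/-- The denominator `p_1 + … + p_i - i`, where `p_j` is the number of elements of `σ_j`. -/
def denom {n : ℕ} (σ : Fin n → Finset (Fin (2 * n))) (i : Fin n) : ℝ :=
  ((∑ j ∈ Finset.univ.filter (fun j => j ≤ i), (σ j).card : ℕ) : ℝ) - ((i : ℕ) + 1)

/-- The right-hand side of the non-recursive formula; the factors are multiplied in the order
`i = n, …, 2, 1` from left to right. -/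
def diagFormula [NeZero d] (B : Fin d → Eucl d → R) (v : Eucl d → R) (n : ℕ) (x : Eucl d) : R :=
  ∑ σ ∈ families n, ∑ ν ∈ indexValues σ,
    ((List.finRange n).reverse.map fun i =>
      (denom σ i)⁻¹ • omega B v (indexList (σ i) ν) x).prod

end

end SeeleyDeWitt

attribute [local instance] Matrix.linftyOpNormedRing Matrix.linftyOpNormedAlgebra

/-! Fix `y` and use coordinates x centred at `y`. Near `y` the function g = a₀(·,y) is invertible.
Conjugation by g turns D_μ into ∂_μ + w_μ, and the transport equation becomes the Fock–Schwinger
condition ∑ x^μ w_μ = 0 (`gauge_radial`). The functions b_n = g⁻¹ a_n then satisfy b₀ = 1 and (n + 1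
+ x·∂) b_{n+1} = (∂_μ∂_μ + 2 w_μ∂_μ + P) b_n with P = ∂_μ w_μ + w_μ w_μ + g⁻¹vg
(`heat_recurrence_gauge`).

At `y` a derivative of order r turns n + 1 + x·∂ into the number n + 1 + r. By the Leibniz rule each
derivative of b_{n+1} at `y` is thus a sum of Taylor coefficients of w and P times derivatives of
b_n, and iteration ends at b₀ = 1. Labels name the derivatives still to be distributed. The last set
of a family records the labels spent on the coefficient: none for ∂_μ∂_μ, one label of the newest
pair and some older ones for 2 w_μ∂_μ, both labels of that pair and some older ones for P. This is
`familySum_eq_ev`.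

In the Fock–Schwinger gauge ∇ acts along rays from `y` as the plain derivative, so directional
derivatives of w and P are contractions of covariant derivatives of F and v. Polarization
(`symm_eq_of_contract`) turns this into symmetrized tensors, which are the Ω̃ (`omegaOff_eq`,
`omegaDiag_eq`). As g(y) = 1, covariant quantities at `y` are the same in both gauges. All of this
is algebra in a `JetAlgebra`; `smoothJet` supplies the analytic instance. -/

namespace SeeleyDeWitt

/-! ### Contraction of tensors with a vector -/

section Contract

variable {d : ℕ} {M N : Type*} [AddCommGroup M] [Module ℝ M] [AddCommGroup N] [Module ℝ N]

/-- The contraction `∑ h^{α₁} ⋯ h^{α_k} T_α` of all places of a tensor with the vector `h`. -/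
def contract (h : Fin d → ℝ) : ℕ → (List (Fin d) → M) → M
  | 0, T => T []
  | k + 1, T => ∑ μ, h μ • contract h k fun α => T (μ :: α)

theorem contract_map (L : M →ₗ[ℝ] N) (h : Fin d → ℝ) (k : ℕ) (T : List (Fin d) → M) :
    contract h k (fun α => L (T α)) = L (contract h k T) := by
  induction k generalizing T with
  | zero => rfl
  | succ k ih => simp only [contract, map_sum, map_smul, ih]

theorem contract_smul (r : ℝ) (h : Fin d → ℝ) (k : ℕ) (T : List (Fin d) → M) :
    contract h k (fun α => r • T α) = r • contract h k T :=
  contract_map (LinearMap.lsmul ℝ M r) h k T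

theorem contract_sum {ι : Type*} (s : Finset ι) (h : Fin d → ℝ) (k : ℕ)
    (T : ι → List (Fin d) → M) :
    contract h k (fun α => ∑ i ∈ s, T i α) = ∑ i ∈ s, contract h k (T i) := by
  induction k generalizing T with
  | zero => rfl
  | succ k ih =>
    simp only [contract, ih, Finset.smul_sum]
    exact Finset.sum_comm

theorem contract_mul {R : Type*} [Ring R] [Algebra ℝ R] (h : Fin d → ℝ) (k l : ℕ)
    (T S : List (Fin d) → R) :
    contract h (k + l) (fun α => T (α.take k) * S (α.drop k))
      = contract h k T * contract h l S := by
  induction k generalizing T with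
  | zero =>
    simpa [contract] using contract_map (LinearMap.mulLeft ℝ (T [])) h l S
  | succ k ih =>
    rw [Nat.succ_add]
    simp only [contract, List.take_succ_cons, List.drop_succ_cons, Finset.sum_mul,
      smul_mul_assoc]
    exact Finset.sum_congr rfl fun μ _ => by rw [ih fun α => T (μ :: α)]

theorem contract_eq_sum (h : Fin d → ℝ) (k : ℕ) (T : List (Fin d) → M) :
    contract h k T = ∑ α : Fin k → Fin d, (∏ i, h (α i)) • T (List.ofFn α) := by
  induction k generalizing T with
  | zero => simp [contract]
  | succ k ih =>
    rw [← (Fin.consEquiv fun _ : Fin (k + 1) => Fin d).sum_comp, Fintype.sum_prod_type]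
    simp only [contract, ih, Finset.smul_sum, smul_smul]
    refine Finset.sum_congr rfl fun μ _ => Finset.sum_congr rfl fun α _ => ?_
    simp [Fin.consEquiv, Fin.prod_univ_succ, List.ofFn_succ]

end Contract

/-! ### Symmetric tensors and their homogeneous polynomials. -/

section Polarization

variable {d : ℕ} {R : Type*} [NormedRing R] [NormedAlgebra ℝ R]

/-- The multilinear form with the components `T α`, for lists `α` of length `k`. -/
noncomputable def tensorForm (k : ℕ) (T : List (Fin d) → R) : (Fin d → ℝ) [×k]→L[ℝ] R :=
  ∑ α : Fin k → Fin d,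
    (ContinuousMultilinearMap.mkPiRing ℝ (Fin k) (T (List.ofFn α))).compContinuousLinearMap
      fun i => ContinuousLinearMap.proj (α i)

theorem tensorForm_apply (k : ℕ) (T : List (Fin d) → R) (v : Fin k → Fin d → ℝ) :
    tensorForm k T v = ∑ α : Fin k → Fin d, (∏ i, v i (α i)) • T (List.ofFn α) := by
  simp [tensorForm]

theorem tensorForm_single (k : ℕ) (T : List (Fin d) → R) (γ : Fin k → Fin d) :
    tensorForm k T (fun i => Pi.single (γ i) 1) = T (List.ofFn γ) := by
  rw [tensorForm_apply, Finset.sum_eq_single γ]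
  · simp
  · intro α _ hα
    obtain ⟨i, hi⟩ := Function.ne_iff.mp hα
    rw [Finset.prod_eq_zero (Finset.mem_univ i) (by simp [hi]), zero_smul]
  · simp

/-- Polarization: the symmetrization of a tensor is determined by its contractions. -/
theorem symm_eq_of_contract {T S : List (Fin d) → R} (γ : List (Fin d))
    (hTS : ∀ h, contract h γ.length T = contract h γ.length S) : symm T γ = symm S γ := by
  -- The permutation sum is the full derivative at 0, along basis vectors, of the homogeneous
  -- polynomial defined by the contractions.
  have key : ∀ T : List (Fin d) → R,
      ∑ π : Equiv.Perm (Fin γ.length), T (List.ofFn fun s => γ.get (π s))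
        = iteratedFDeriv ℝ γ.length (fun h => contract h γ.length T) 0
            (fun i => Pi.single (γ.get i) 1) := by
    intro T
    have e : (fun h => contract h γ.length T) = fun h => tensorForm γ.length T fun _ => h := by
      funext h
      rw [tensorForm_apply, contract_eq_sum]
    rw [e, ContinuousMultilinearMap.iteratedFDeriv_comp_diagonal]
    exact Finset.sum_congr rfl fun π _ => (tensorForm_single _ T fun s => γ.get (π s)).symm
  rw [symm, symm, key, key, funext hTS]

theorem symm_of_perm {T : List (Fin d) → R} (hT : ∀ α β, α.Perm β → T α = T β)
    (γ : List (Fin d)) : symm T γ = T γ := by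
  have key : ∀ π : Equiv.Perm (Fin γ.length), T (List.ofFn fun s => γ.get (π s)) = T γ := by
    intro π
    apply hT
    have := Equiv.Perm.ofFn_comp_perm π γ.get
    simpa [Function.comp_def] using this
  simp only [symm, key, Finset.sum_const, Finset.card_univ, Fintype.card_perm, Fintype.card_fin]
  rw [← Nat.cast_smul_eq_nsmul ℝ, smul_smul, inv_mul_cancel₀, one_smul]
  exact_mod_cast Nat.factorial_ne_zero _

end Polarization

/-! ### Algebras with commuting derivations and central coordinates -/

/-- An algebra `A` with commuting derivations `D μ`, central coordinates `X μ`, and an evaluation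
at the origin of the coordinates. -/
structure JetAlgebra (d : ℕ) (A R : Type*) [Ring A] [Algebra ℝ A] [Ring R] [Algebra ℝ R] where
  D : Fin d → A →ₗ[ℝ] A
  leibniz : ∀ μ f g, D μ (f * g) = D μ f * g + f * D μ g
  D_comm : ∀ μ ν f, D μ (D ν f) = D ν (D μ f)
  X : Fin d → A
  X_comm : ∀ μ f, X μ * f = f * X μ
  D_X : ∀ μ ν, D μ (X ν) = if μ = ν then 1 else 0
  ev : A →ₐ[ℝ] R
  ev_X : ∀ μ, ev (X μ) = 0

namespace JetAlgebra

variable {d : ℕ} {A R : Type*} [Ring A] [Algebra ℝ A] [Ring R] [Algebra ℝ R]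
  (J : JetAlgebra d A R)

theorem D_one (μ : Fin d) : J.D μ 1 = 0 := by
  have := J.leibniz μ 1 1
  simpa using this

/-- The iterated derivative `∂_{γ₁} ⋯ ∂_{γ_r}`. -/
def iterD : List (Fin d) → A →ₗ[ℝ] A
  | [] => LinearMap.id
  | μ :: γ => J.D μ ∘ₗ iterD γ

@[simp] theorem iterD_nil (f : A) : J.iterD [] f = f := rfl

@[simp] theorem iterD_cons (μ : Fin d) (γ : List (Fin d)) (f : A) :
    J.iterD (μ :: γ) f = J.D μ (J.iterD γ f) := rfl

theorem iterD_perm {γ γ' : List (Fin d)} (h : γ.Perm γ') : J.iterD γ = J.iterD γ' := by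
  induction h with
  | nil => rfl
  | cons μ _ ih => ext f; simp [ih]
  | swap μ ν γ => ext f; simp [J.D_comm μ ν]
  | trans _ _ ih₁ ih₂ => exact ih₁.trans ih₂

theorem iterD_append (γ γ' : List (Fin d)) (f : A) :
    J.iterD (γ ++ γ') f = J.iterD γ (J.iterD γ' f) := by
  induction γ with
  | nil => rfl
  | cons μ γ ih => simp [ih]

/-- The Euler operator `x^μ ∂_μ`. -/
def euler : A →ₗ[ℝ] A := ∑ μ, LinearMap.mulLeft ℝ (J.X μ) ∘ₗ J.D μ

theorem euler_apply (f : A) : J.euler f = ∑ μ, J.X μ * J.D μ f := by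
  simp [euler, LinearMap.sum_apply]

theorem ev_euler (f : A) : J.ev (J.euler f) = 0 := by
  simp [euler_apply, J.ev_X]

theorem D_euler (μ : Fin d) (f : A) : J.D μ (J.euler f) = J.euler (J.D μ f) + J.D μ f := by
  simp only [euler_apply, map_sum, J.leibniz, J.D_X, Finset.sum_add_distrib, ite_mul, one_mul,
    zero_mul, Finset.sum_ite_eq, Finset.mem_univ, if_true, J.D_comm μ]
  exact add_comm _ _

theorem iterD_euler (γ : List (Fin d)) (f : A) :
    J.iterD γ (J.euler f) = J.euler (J.iterD γ f) + (γ.length : ℝ) • J.iterD γ f := by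
  induction γ with
  | nil => simp
  | cons μ γ ih =>
    simp only [iterD_cons, ih, map_add, map_smul, D_euler, List.length_cons, Nat.cast_succ,
      add_smul, one_smul]
    abel

/-- Each ∂ commuted past x·∂ adds one copy of itself, and x·∂ vanishes at the origin. This is the
source of the denominators in the formula. -/
theorem ev_iterD_euler (γ : List (Fin d)) (f : A) :
    J.ev (J.iterD γ (J.euler f)) = (γ.length : ℝ) • J.ev (J.iterD γ f) := by
  simp [iterD_euler, ev_euler]

/-! ### Directional derivatives -/

/-- The derivative `h^μ ∂_μ`. -/
def dirD (h : Fin d → ℝ) : A →ₗ[ℝ] A := ∑ μ, h μ • J.D μ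

theorem dirD_apply (h : Fin d → ℝ) (f : A) : J.dirD h f = ∑ μ, h μ • J.D μ f := by
  simp [dirD, LinearMap.sum_apply]

theorem dirD_mul (h : Fin d → ℝ) (f g : A) :
    J.dirD h (f * g) = J.dirD h f * g + f * J.dirD h g := by
  simp [dirD_apply, J.leibniz, Finset.sum_add_distrib, Finset.sum_mul, Finset.mul_sum]

theorem dirD_X (h : Fin d → ℝ) (μ : Fin d) : J.dirD h (J.X μ) = h μ • 1 := by
  simp [dirD_apply, J.D_X]

/-- The iterated derivative `(h^μ ∂_μ)^k`. -/
def dirDPow (h : Fin d → ℝ) : ℕ → A →ₗ[ℝ] A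
  | 0 => LinearMap.id
  | k + 1 => J.dirD h ∘ₗ dirDPow h k

@[simp] theorem dirDPow_zero (h : Fin d → ℝ) (f : A) : J.dirDPow h 0 f = f := rfl

theorem dirDPow_succ (h : Fin d → ℝ) (k : ℕ) (f : A) :
    J.dirDPow h (k + 1) f = J.dirD h (J.dirDPow h k f) := rfl

theorem dirDPow_succ' (h : Fin d → ℝ) (k : ℕ) (f : A) :
    J.dirDPow h (k + 1) f = J.dirDPow h k (J.dirD h f) := by
  induction k with
  | zero => rfl
  | succ k ih => rw [dirDPow_succ, ih, dirDPow_succ]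

theorem contract_iterD (h : Fin d → ℝ) (k : ℕ) (f : A) :
    contract h k (fun α => J.iterD α f) = J.dirDPow h k f := by
  induction k with
  | zero => rfl
  | succ k ih =>
    simp only [contract, iterD_cons, contract_map, ih, dirDPow_succ, dirD_apply]

theorem contract_ev_iterD (h : Fin d → ℝ) (k : ℕ) (f : A) :
    contract h k (fun α => J.ev (J.iterD α f)) = J.ev (J.dirDPow h k f) := by
  rw [← contract_iterD]
  exact contract_map J.ev.toLinearMap h k fun α => J.iterD α f

theorem dirDPow_mul (h : Fin d → ℝ) (n : ℕ) (f g : A) :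
    J.dirDPow h n (f * g) = ∑ i ∈ Finset.range (n + 1),
      n.choose i • (J.dirDPow h i f * J.dirDPow h (n - i) g) := by
  rw [← Finset.Nat.sum_antidiagonal_eq_sum_range_succ
    (fun i j => n.choose i • (J.dirDPow h i f * J.dirDPow h j g))]
  induction n with
  | zero => simp
  | succ n ih =>
    rw [Finset.sum_antidiagonal_choose_succ_nsmul
      (fun i j => J.dirDPow h i f * J.dirDPow h j g), dirDPow_succ, ih, map_sum, add_comm,
      ← Finset.sum_add_distrib]
    refine Finset.sum_congr rfl fun p hp => ?_
    have hp := Finset.HasAntidiagonal.mem_antidiagonal.mp hp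
    rw [map_nsmul, dirD_mul, smul_add, dirDPow_succ, dirDPow_succ, ← hp, Nat.choose_symm_add]

theorem dirDPow_X_mul (h : Fin d → ℝ) (k : ℕ) (μ : Fin d) (f : A) :
    J.dirDPow h (k + 1) (J.X μ * f)
      = J.X μ * J.dirDPow h (k + 1) f + ((k + 1 : ℝ) * h μ) • J.dirDPow h k f := by
  induction k with
  | zero =>
    simp only [dirDPow_succ, dirDPow_zero, dirD_mul, dirD_X, smul_mul_assoc, one_mul]
    simp [add_comm]
  | succ k ih =>
    rw [dirDPow_succ, ih, map_add, dirD_mul, map_smul, dirD_X, ← dirDPow_succ, ← dirDPow_succ]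
    push_cast
    simp only [smul_mul_assoc, one_mul, add_mul, add_smul]
    abel

/-- At the origin only the Leibniz terms with exactly one derivative on the coordinate survive, and
there are k + 1 of them. -/
theorem ev_dirDPow_X_mul (h : Fin d → ℝ) (k : ℕ) (μ : Fin d) (f : A) :
    J.ev (J.dirDPow h (k + 1) (J.X μ * f)) = ((k + 1 : ℝ) * h μ) • J.ev (J.dirDPow h k f) := by
  rw [dirDPow_X_mul, map_add, map_mul, J.ev_X, zero_mul, zero_add, map_smul]

/-! ### Connections -/

/-- The covariant derivative `∇_μ f = ∂_μ f + [B_μ, f]`. -/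
def nab (B : Fin d → A) (μ : Fin d) : A →ₗ[ℝ] A :=
  J.D μ + (LinearMap.mulLeft ℝ (B μ) - LinearMap.mulRight ℝ (B μ))

theorem nab_apply (B : Fin d → A) (μ : Fin d) (f : A) :
    J.nab B μ f = J.D μ f + (B μ * f - f * B μ) := by
  simp [nab]

/-- The curvature of the connection `B`. -/
def cur (B : Fin d → A) (μ ν : Fin d) : A :=
  J.D μ (B ν) - J.D ν (B μ) + (B μ * B ν - B ν * B μ)

/-- `∇_{α₁} ⋯ ∇_{α_r} f`. -/
def nabs (B : Fin d → A) (f : A) : List (Fin d) → A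
  | [] => f
  | μ :: α => J.nab B μ (nabs B f α)

/-- `∇_{α₁} ⋯ ∇_{α_{r-1}} F_{α_r c}`. -/
def nabsF (B : Fin d → A) (c : Fin d) : List (Fin d) → A
  | [] => 0
  | [μ] => J.cur B μ c
  | μ :: ν :: α => J.nab B μ (nabsF B c (ν :: α))

/-- The zeroth order part of `(∂_μ + w_μ)(∂_μ + w_μ) + f`. -/
def potential (w : Fin d → A) (f : A) : A := ∑ μ, (J.D μ (w μ) + w μ * w μ) + f

/-! ### Gauge transformations -/

section Gauge

variable (B : Fin d → A) (g : Aˣ)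

/-- The gauge transform `g⁻¹ (∂_μ + B_μ) g - ∂_μ` of a connection. -/
def gauge (μ : Fin d) : A := ↑g⁻¹ * (J.D μ g + B μ * g)

theorem D_mul_gauge (μ : Fin d) (f : A) :
    J.D μ (g * f) + B μ * (g * f) = g * (J.D μ f + J.gauge B g μ * f) := by
  simp only [gauge, J.leibniz, mul_add, add_mul, ← mul_assoc, Units.mul_inv, one_mul]
  abel

theorem D_inv (μ : Fin d) : J.D μ (↑g⁻¹ : A) = -(↑g⁻¹ * J.D μ g * ↑g⁻¹) := by
  have h := J.leibniz μ (↑g⁻¹ : A) g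
  rw [Units.inv_mul, J.D_one] at h
  have h2 := congrArg (fun z => z * (↑g⁻¹ : A)) h
  simp only [zero_mul, add_mul, mul_assoc, Units.mul_inv, mul_one] at h2
  rw [mul_assoc]
  exact eq_neg_of_add_eq_zero_left h2.symm

theorem nab_conj (μ : Fin d) (f : A) :
    ↑g⁻¹ * J.nab B μ f * g = J.nab (J.gauge B g) μ (↑g⁻¹ * f * g) := by
  -- Cancels g g⁻¹ inside right-associated products, so that both sides expand to the same
  -- monomials.
  have c : ∀ z : A, g * (↑g⁻¹ * z) = z := fun z => by rw [← mul_assoc, Units.mul_inv, one_mul]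
  simp only [nab_apply, gauge, J.leibniz, D_inv, mul_add, add_mul, mul_sub, sub_mul, mul_assoc,
    neg_mul, c]
  abel

theorem cur_gauge (μ ν : Fin d) : J.cur (J.gauge B g) μ ν = ↑g⁻¹ * J.cur B μ ν * g := by
  have c : ∀ z : A, g * (↑g⁻¹ * z) = z := fun z => by rw [← mul_assoc, Units.mul_inv, one_mul]
  simp only [cur, gauge, J.leibniz, D_inv, map_add, mul_add, add_mul, mul_sub, sub_mul, mul_assoc,
    neg_mul, c, J.D_comm μ ν]
  abel

theorem nabs_gauge (f : A) (α : List (Fin d)) :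
    J.nabs (J.gauge B g) (↑g⁻¹ * f * g) α = ↑g⁻¹ * J.nabs B f α * g := by
  induction α with
  | nil => rfl
  | cons μ α ih => rw [nabs, ih, nabs, nab_conj]

theorem nabsF_gauge (c : Fin d) (α : List (Fin d)) :
    J.nabsF (J.gauge B g) c α = ↑g⁻¹ * J.nabsF B c α * g := by
  induction α with
  | nil => simp [nabsF]
  | cons μ α ih =>
    cases α with
    | nil => exact J.cur_gauge B g μ c
    | cons ν α => rw [nabsF, ih, nabsF, nab_conj]

end Gauge

/-! ### The Fock–Schwinger gauge -/

section FockSchwinger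

variable {w : Fin d → A}

theorem ev_connection (hw : ∑ μ, J.X μ * w μ = 0) (ν : Fin d) : J.ev (w ν) = 0 := by
  have := congrArg (fun z => J.ev (J.D ν z)) hw
  simpa [J.leibniz, J.D_X, J.ev_X, Finset.sum_add_distrib] using this

/-- Applying (h·∂)^{k+1} to x·w = 0 at the origin leaves k + 1 times this expression. -/
theorem ev_dirDPow_radial (hw : ∑ μ, J.X μ * w μ = 0) (h : Fin d → ℝ) (k : ℕ) :
    J.ev (J.dirDPow h k (∑ μ, h μ • w μ)) = 0 := by
  have := congrArg (fun z => J.ev (J.dirDPow h (k + 1) z)) hw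
  simp only [map_sum, ev_dirDPow_X_mul, map_zero, mul_smul, ← Finset.smul_sum] at this
  simpa only [map_sum, map_smul] using
    (smul_eq_zero.mp this).resolve_left (by positivity)

/-- Here ∂_ν is applied to x·w = 0 first: on the coordinate it produces w_ν, on w it produces the
right-hand side. -/
theorem ev_dirDPow_D_radial (hw : ∑ μ, J.X μ * w μ = 0) (h : Fin d → ℝ) (k : ℕ) (ν : Fin d) :
    J.ev (J.dirDPow h (k + 1) (w ν))
      = -((k + 1 : ℝ) • J.ev (J.dirDPow h k (J.D ν (∑ μ, h μ • w μ)))) := by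
  have := congrArg (fun z => J.ev (J.dirDPow h (k + 1) (J.D ν z))) hw
  simp only [map_sum, J.leibniz, map_add, J.D_X, ite_mul, one_mul, zero_mul,
    Finset.sum_add_distrib, ev_dirDPow_X_mul, map_zero, mul_smul, ← Finset.smul_sum] at this
  rw [eq_neg_iff_add_eq_zero, ← this]
  congr 1
  · simp [Finset.sum_ite_eq, apply_ite]
  · simp only [map_sum, map_smul]

/-- Along the ray with direction `h`, the covariant derivative is the derivative. -/
theorem ev_dirDPow_contract_nab (hw : ∑ μ, J.X μ * w μ = 0) (h : Fin d → ℝ) {f g : A}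
    (hfg : ∀ k, J.ev (J.dirDPow h k f) = J.ev (J.dirDPow h k g)) (k : ℕ) :
    J.ev (J.dirDPow h k (∑ μ, h μ • J.nab w μ f)) = J.ev (J.dirDPow h k (J.dirD h g)) := by
  have e : ∑ μ, h μ • J.nab w μ f
      = J.dirD h f + ((∑ μ, h μ • w μ) * f - f * ∑ μ, h μ • w μ) := by
    simp only [nab_apply, dirD_apply, smul_add, smul_sub, Finset.sum_add_distrib,
      Finset.sum_sub_distrib, Finset.sum_mul, Finset.mul_sum, smul_mul_assoc, mul_smul_comm]
  -- Every Leibniz term of the commutator with h·w contains a derivative of h·w along h at the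
  -- origin, which is zero.
  have r := J.ev_dirDPow_radial hw h
  rw [e]
  generalize ∑ μ, h μ • w μ = z at r
  rw [map_add, map_sub, dirDPow_mul, dirDPow_mul, ← dirDPow_succ', ← dirDPow_succ']
  simp only [map_add, map_sub, map_sum, map_nsmul, map_mul, r, zero_mul, mul_zero, smul_zero,
    Finset.sum_const_zero, sub_zero, add_zero, hfg]

/-- The two elements agree only in their jets along h at the origin, not in `A`; the extra j
derivatives keep the whole jet available to the induction. -/
theorem ev_dirDPow_contract_nabs (hw : ∑ μ, J.X μ * w μ = 0) (f : A) (h : Fin d → ℝ)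
    (k j : ℕ) :
    J.ev (J.dirDPow h j (contract h k (J.nabs w f))) = J.ev (J.dirDPow h j (J.dirDPow h k f)) := by
  induction k generalizing j with
  | zero => rfl
  | succ k ih =>
    have e : contract h (k + 1) (J.nabs w f)
        = ∑ μ, h μ • J.nab w μ (contract h k (J.nabs w f)) := by
      simp only [contract, nabs, contract_map]
    rw [e, J.ev_dirDPow_contract_nab hw h (fun i => ih i), dirDPow_succ]

theorem ev_dirDPow_contract_nabsF (hw : ∑ μ, J.X μ * w μ = 0) (c : Fin d) (h : Fin d → ℝ)
    (k j : ℕ) :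
    J.ev (J.dirDPow h j (contract h (k + 1) (J.nabsF w c)))
      = J.ev (J.dirDPow h j (J.dirDPow h k (∑ μ, h μ • J.cur w μ c))) := by
  induction k generalizing j with
  | zero => rfl
  | succ k ih =>
    have e : contract h (k + 1 + 1) (J.nabsF w c)
        = ∑ μ, h μ • J.nab w μ (contract h (k + 1) (J.nabsF w c)) := by
      simp only [contract, nabsF, contract_map, map_sum, map_smul]
    rw [e, J.ev_dirDPow_contract_nab hw h (fun i => ih i), dirDPow_succ]

theorem ev_dirDPow_contract_cur (hw : ∑ μ, J.X μ * w μ = 0) (c : Fin d) (h : Fin d → ℝ)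
    (k : ℕ) :
    J.ev (J.dirDPow h k (∑ μ, h μ • J.cur w μ c))
      = J.ev (J.dirDPow h (k + 1) (w c))
        - J.ev (J.dirDPow h k (J.D c (∑ μ, h μ • w μ))) := by
  have e : ∑ μ, h μ • J.cur w μ c = J.dirD h (w c) - J.D c (∑ μ, h μ • w μ)
      + ((∑ μ, h μ • w μ) * w c - w c * ∑ μ, h μ • w μ) := by
    simp only [cur, dirD_apply, smul_add, smul_sub, Finset.sum_add_distrib, map_sum, map_smul,
      Finset.sum_sub_distrib, Finset.sum_mul, Finset.mul_sum, smul_mul_assoc, mul_smul_comm]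
  have r := J.ev_dirDPow_radial hw h
  rw [e]
  generalize ∑ μ, h μ • w μ = z at r
  rw [map_add, map_sub, map_sub, dirDPow_mul, dirDPow_mul, ← dirDPow_succ']
  simp only [map_add, map_sub, map_sum, map_nsmul, map_mul, r, zero_mul, mul_zero, smul_zero,
    Finset.sum_const_zero, sub_zero, add_zero]

theorem ev_contract_nabs (hw : ∑ μ, J.X μ * w μ = 0) (f : A) (h : Fin d → ℝ) (k : ℕ) :
    contract h k (fun α => J.ev (J.nabs w f α)) = J.ev (J.dirDPow h k f) :=
  (contract_map J.ev.toLinearMap h k _).trans (J.ev_dirDPow_contract_nabs hw f h k 0)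

/-- The Taylor coefficients of a connection in the Fock–Schwinger gauge. -/
theorem ev_contract_nabsF (hw : ∑ μ, J.X μ * w μ = 0) (c : Fin d) (h : Fin d → ℝ) (k : ℕ) :
    ((k : ℝ) / (k + 1)) • contract h k (fun α => J.ev (J.nabsF w c α))
      = J.ev (J.dirDPow h k (w c)) := by
  cases k with
  | zero => simp [J.ev_connection hw]
  | succ k =>
    have e : contract h (k + 1) (fun α => J.ev (J.nabsF w c α))
        = J.ev (J.dirDPow h k (∑ μ, h μ • J.cur w μ c)) :=
      (contract_map J.ev.toLinearMap h (k + 1) _).trans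
        (J.ev_dirDPow_contract_nabsF hw c h k 0)
    -- With u the derivative of w_c of order k + 1 and z that of ∂_c(h·w) of order k, the
    -- contraction of ∇⋯∇F is u − z and u = −(k + 1)z. Hence the factor (k + 1)/(k + 2).
    have r := J.ev_dirDPow_D_radial hw h k c
    rw [e, J.ev_dirDPow_contract_cur hw]
    generalize J.ev (J.dirDPow h k (J.D c (∑ μ, h μ • w μ))) = z at r
    rw [r]
    have : (k : ℝ) + 1 + 1 ≠ 0 := by positivity
    push_cast
    match_scalars
    field_simp
    ring

end FockSchwinger

end JetAlgebra

/-! ### The tensors as Taylor coefficients -/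

section Symm

variable {d : ℕ} {R : Type*} [NormedRing R] [NormedAlgebra ℝ R]

theorem symm_smul (r : ℝ) (T : List (Fin d) → R) (γ : List (Fin d)) :
    symm (fun β => r • T β) γ = r • symm T γ := by
  rw [symm, symm, ← Finset.smul_sum, smul_comm]

theorem symm_sum {ι : Type*} (s : Finset ι) (T : ι → List (Fin d) → R) (γ : List (Fin d)) :
    symm (fun β => ∑ i ∈ s, T i β) γ = ∑ i ∈ s, symm (T i) γ := by
  simp only [symm, ← Finset.smul_sum]
  rw [Finset.sum_comm]

end Symm

namespace JetAlgebra

variable {d : ℕ} {A R : Type*} [Ring A] [Algebra ℝ A] [NormedRing R] [NormedAlgebra ℝ R]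
  (J : JetAlgebra d A R) {w : Fin d → A}

/-- Partial derivatives commute, so they equal their own symmetrization, which polarization recovers
from directional derivatives. -/
theorem ev_iterD_eq_symm {f : A} {T : List (Fin d) → R} (γ : List (Fin d))
    (hT : ∀ h, contract h γ.length T = J.ev (J.dirDPow h γ.length f)) :
    J.ev (J.iterD γ f) = symm T γ := by
  rw [← symm_of_perm (T := fun γ => J.ev (J.iterD γ f))
    (fun α β h => by rw [J.iterD_perm h]) γ]
  exact symm_eq_of_contract γ fun h => by rw [contract_ev_iterD, hT]

theorem ev_iterD_nabs (hw : ∑ μ, J.X μ * w μ = 0) (f : A) (γ : List (Fin d)) :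
    J.ev (J.iterD γ f) = symm (fun α => J.ev (J.nabs w f α)) γ :=
  J.ev_iterD_eq_symm γ fun h => J.ev_contract_nabs hw f h _

theorem ev_iterD_nabsF (hw : ∑ μ, J.X μ * w μ = 0) (c : Fin d) (γ : List (Fin d)) :
    J.ev (J.iterD γ (w c))
      = ((γ.length : ℝ) / (γ.length + 1)) • symm (fun α => J.ev (J.nabsF w c α)) γ := by
  rw [← symm_smul]
  exact J.ev_iterD_eq_symm γ fun h => by rw [contract_smul, J.ev_contract_nabsF hw c h]

/-- The constant of the quadratic term of Ω̃ for k = N + 2: a binomial coefficient from the Leibniz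
rule, times the factor r/(r + 1) of each connection, with n + 1 derivatives on the right one. -/
theorem quadratic_coeff (N n : ℕ) (hn : n + 1 < N) :
    (((n : ℝ) + 1) * (((N + 2 : ℕ) : ℝ) - n - 3) * (N + 2 - 2).factorial)
        / ((n + 2).factorial * (N + 2 - n - 2).factorial)
      = (N.choose (N - (n + 1)) : ℝ) * (((N - (n + 1) : ℕ) : ℝ) / ((N - (n + 1) : ℕ) + 1))
        * (((n + 1 : ℕ) : ℝ) / ((n + 1 : ℕ) + 1)) := by
  obtain ⟨i, rfl⟩ : ∃ i, N = i + (n + 1) := ⟨N - (n + 1), by omega⟩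
  have e1 : i + (n + 1) + 2 - n - 2 = i + 1 := by omega
  have e2 : i + (n + 1) - (n + 1) = i := by omega
  have h := Nat.add_choose_mul_factorial_mul_factorial i (n + 1)
  rw [← Nat.choose_symm_add] at h
  have h' : ((i + (n + 1)).choose i : ℝ) * i.factorial * (n + 1).factorial
      = (i + (n + 1)).factorial := by exact_mod_cast h
  rw [e1, e2, Nat.add_sub_cancel, ← h', Nat.factorial_succ (n + 1), Nat.factorial_succ i]
  have := Nat.factorial_ne_zero i
  have := Nat.factorial_ne_zero (n + 1)
  push_cast
  field_simp
  ring

theorem ev_iterD_mul_self (hw : ∑ μ, J.X μ * w μ = 0) (c : Fin d) (γ : List (Fin d)) :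
    J.ev (J.iterD γ (w c * w c))
      = ∑ n ∈ Finset.range (γ.length + 2 - 3),
          ((((n : ℝ) + 1) * (((γ.length + 2 : ℕ) : ℝ) - n - 3) * (γ.length + 2 - 2).factorial)
            / ((n + 2).factorial * (γ.length + 2 - n - 2).factorial)) •
          symm (fun β => J.ev (J.nabsF w c (β.take (γ.length + 2 - n - 3)))
            * J.ev (J.nabsF w c (β.drop (γ.length + 2 - n - 3)))) γ := by
  simp only [← symm_smul]
  rw [← symm_sum]
  refine J.ev_iterD_eq_symm γ fun h => ?_
  generalize γ.length = N
  rw [contract_sum, dirDPow_mul, map_sum]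
  have h0 : J.ev (J.dirDPow h 0 (w c)) = 0 := J.ev_connection hw c
  rcases N with _ | N
  · simp [J.ev_connection hw]
  -- The two extreme Leibniz terms contain an undifferentiated w_c, which vanishes at the origin;
  -- this explains the range of the quadratic sum.
  rw [Finset.sum_range_succ, Finset.sum_range_succ', Nat.sub_self, map_nsmul, map_nsmul, map_mul,
    map_mul, h0, zero_mul, mul_zero, smul_zero, smul_zero, add_zero, add_zero]
  -- The Leibniz sum counts derivatives on the left factor, Ω̃ those on the right.
  conv_rhs => rw [← Finset.sum_range_reflect]
  refine Finset.sum_congr rfl fun n hn => ?_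
  have hn : n < N := by simpa using hn
  rw [contract_smul, quadratic_coeff _ _ (by omega)]
  have e1 : N + 1 + 2 - n - 3 = N + 1 - (n + 1) := by omega
  have e2 : N - 1 - n + 1 = N + 1 - (n + 1) := by omega
  have e3 : N + 1 - (N + 1 - (n + 1)) = n + 1 := by omega
  have e4 : N + 1 - (n + 1) + (n + 1) = N + 1 := by omega
  have hc := contract_mul h (N + 1 - (n + 1)) (n + 1) (fun α => J.ev (J.nabsF w c α))
    (fun α => J.ev (J.nabsF w c α))
  rw [e4] at hc
  rw [e1, e2, e3, hc, map_nsmul, map_mul, ← J.ev_contract_nabsF hw c h,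
    ← J.ev_contract_nabsF hw c h, ← Nat.cast_smul_eq_nsmul ℝ, smul_mul_smul_comm, smul_smul,
    mul_assoc]

/-- The factor 2(k − 1)/k is the 2 of 2 w_μ∂_μ times the Taylor factor of w at order k − 1. -/
theorem omegaOff_eq (hw : ∑ μ, J.X μ * w μ = 0) {B : Fin d → Eucl d → R} {x : Eucl d}
    (hF : ∀ c α, nablasF B c α x = J.ev (J.nabsF w c α)) (α : List (Fin d)) (c : Fin d) :
    omegaOff B α c x = (2 : ℝ) • J.ev (J.iterD α (w c)) := by
  rw [omegaOff, J.ev_iterD_nabsF hw, smul_smul, mul_div_assoc]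
  simp only [hF]

theorem omegaDiag_eq (hw : ∑ μ, J.X μ * w μ = 0) {B : Fin d → Eucl d → R} {v : Eucl d → R}
    {f : A} {x : Eucl d} (hv : ∀ α, nablas B v α x = J.ev (J.nabs w f α))
    (hF : ∀ c α, nablasF B c α x = J.ev (J.nabsF w c α)) (α : List (Fin d)) :
    omegaDiag B v α x = J.ev (J.iterD α (J.potential w f)) := by
  -- The divergence index counts as one more derivative, so the Taylor factor is taken at order k −
  -- 1.
  have hD : ∀ c, J.ev (J.iterD α (J.D c (w c)))
      = ((((α.length + 2 : ℕ) : ℝ) - 1) / (α.length + 2 : ℕ)) •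
        symm (fun β => nablasF B c β x) (α ++ [c]) := by
    intro c
    have := J.ev_iterD_nabsF hw c (α ++ [c])
    rw [iterD_append, iterD_cons, iterD_nil] at this
    rw [this]
    simp only [hF, List.length_append, List.length_singleton]
    congr 2 <;> push_cast <;> ring
  rw [omegaDiag, potential]
  -- For k = 2 only v survives: w vanishes at the origin, and so does ∂_c w_c because F_{cc} = 0.
  by_cases hα : α = []
  · subst hα
    have h1 : ∀ c, J.ev (J.D c (w c)) = 0 := by
      intro c
      have := J.ev_iterD_nabsF hw c [c]
      simpa [symm, nabsF, cur] using this
    have h2 := hv []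
    simp only [nablas, nabs] at h2
    simp [J.ev_connection hw, h1, h2]
  · simp only [hα, if_false]
    rw [map_add, map_sum, map_add, map_sum]
    simp only [map_add, Finset.sum_add_distrib, hD, J.ev_iterD_mul_self hw, ← hF, J.ev_iterD_nabs hw f,
      ← hv]
    rw [Finset.sum_comm (s := Finset.univ)]
    simp only [Finset.smul_sum]
    abel

end JetAlgebra

/-! ### Families of label sets -/

section Families

variable {d M : ℕ}

/-- The list of indices of a set of labels, when the labels `2j` and `2j + 1` carry `κ j`. -/
def labelList (s : Finset (Fin M)) (κ : ℕ → Fin d) : List (ℕ × Fin d) :=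
  (s.sort (· ≤ ·)).map fun q : Fin M => ((q : ℕ) / 2, κ ((q : ℕ) / 2))

@[simp] theorem labelList_empty (κ : ℕ → Fin d) : labelList (∅ : Finset (Fin M)) κ = [] := by
  simp [labelList]

theorem labelList_congr {s : Finset (Fin M)} {κ κ' : ℕ → Fin d}
    (h : ∀ q ∈ s, κ ((q : ℕ) / 2) = κ' ((q : ℕ) / 2)) : labelList s κ = labelList s κ' := by
  refine List.map_congr_left fun q hq => ?_
  rw [h q (by simpa using hq)]

theorem labelList_insert_min {s : Finset (Fin M)} {a : Fin M} (h : ∀ q ∈ s, a < q)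
    (κ : ℕ → Fin d) :
    labelList (insert a s) κ = ((a : ℕ) / 2, κ ((a : ℕ) / 2)) :: labelList s κ := by
  rw [labelList, Finset.sort_insert _ (fun q hq => (h q hq).le) fun ha => (h a ha).false]
  rfl

theorem labelList_insert_perm {s : Finset (Fin M)} {a : Fin M} (h : a ∉ s) (κ : ℕ → Fin d) :
    (labelList (insert a s) κ).Perm (((a : ℕ) / 2, κ ((a : ℕ) / 2)) :: labelList s κ) := by
  rw [labelList, labelList, ← List.map_cons (f := fun q : Fin M => ((q : ℕ) / 2, κ ((q : ℕ) / 2)))]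
  refine List.Perm.map _ ?_
  rw [← Multiset.coe_eq_coe, ← Multiset.cons_coe, Finset.sort_eq, Finset.sort_eq,
    Finset.insert_val_of_notMem h]

/-- The conditions on the last member of a family of `n + 1` sets. -/
def IsLastMember (n : ℕ) (s : Finset (Fin M)) : Prop :=
  (∀ q ∈ s, 2 * n ≤ (q : ℕ)) ∧ ((∃ q ∈ s, (q : ℕ) = 2 * n) ∨ s = ∅)

/-- The families of `n` sets of labels with union `U`. -/
def familiesOn (n : ℕ) (U : Finset (Fin M)) : Set (Fin n → Finset (Fin M)) :=
  {σ | (∀ q, q ∈ U ↔ ∃ i, q ∈ σ i)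
    ∧ (∀ i, ∀ q ∈ σ i, 2 * (i : ℕ) ≤ q ∧ ∀ j, i < j → q ∉ σ j)
    ∧ (∀ i, (∃ q ∈ σ i, (q : ℕ) = 2 * i) ∨ σ i = ∅)}

theorem snoc_mem_familiesOn {n : ℕ} {U : Finset (Fin M)} {σ : Fin n → Finset (Fin M)}
    {s : Finset (Fin M)} :
    (Fin.snoc σ s : Fin (n + 1) → Finset (Fin M)) ∈ familiesOn (n + 1) U
      ↔ (s ⊆ U ∧ IsLastMember n s) ∧ σ ∈ familiesOn n (U \ s) := by
  simp only [familiesOn, Set.mem_ofPred_eq, Fin.forall_fin_succ', Fin.exists_fin_succ',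
    Fin.snoc_castSucc, Fin.snoc_last, Fin.val_castSucc, Fin.val_last, Fin.castSucc_lt_castSucc_iff,
    Fin.castSucc_lt_last, IsLastMember, Finset.mem_sdiff, Finset.subset_iff]
  constructor
  · rintro ⟨h1, ⟨h2, h3⟩, h4, h5⟩
    refine ⟨⟨fun q hq => (h1 q).2 (Or.inr hq), fun q hq => (h3 q hq).1, h5⟩, fun q => ?_,
      fun i q hq => ⟨(h2 i q hq).1, fun j hj => (h2 i q hq).2.1 j hj⟩, h4⟩
    constructor
    · rintro ⟨hq, hs⟩
      exact ((h1 q).1 hq).resolve_right hs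
    · rintro ⟨i, hi⟩
      exact ⟨(h1 q).2 (Or.inl ⟨i, hi⟩), (h2 i q hi).2.2 trivial⟩
  · rintro ⟨⟨h1, h2, h3⟩, h4, h5, h6⟩
    refine ⟨fun q => ⟨fun hq => ?_, ?_⟩, ⟨fun i q hq => ⟨(h5 i q hq).1, (h5 i q hq).2,
      fun _ => ((h4 q).2 ⟨i, hq⟩).2⟩, fun q hq => ⟨h2 q hq, fun j hj => ?_, ?_⟩⟩, h6, h3⟩
    · by_cases hs : q ∈ s
      · exact Or.inr hs
      · exact Or.inl ((h4 q).1 ⟨hq, hs⟩)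
    · rintro (h | h)
      · exact ((h4 q).2 h).1
      · exact h1 h
    · exact absurd hj (Fin.castSucc_lt_last j).not_gt
    · exact fun h => absurd h (lt_irrefl _)

/-- The members are pairwise disjoint, so the last denominator depends on `U` alone. -/
theorem card_eq_of_mem_familiesOn {n : ℕ} {U : Finset (Fin M)} {σ : Fin n → Finset (Fin M)}
    (h : σ ∈ familiesOn n U) : ∑ j, (σ j).card = U.card := by
  obtain ⟨h1, h2, -⟩ := h
  have e : U = Finset.univ.biUnion σ := by
    ext q
    simp [h1]
  rw [e, Finset.card_biUnion]
  intro i _ j _ hij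
  change Disjoint (σ i) (σ j)
  rw [Finset.disjoint_left]
  intro q hi hj
  rcases lt_or_gt_of_ne hij with h | h
  · exact (h2 i q hi).2 j h hj
  · exact (h2 j q hj).2 i h hi

/-- The label `2j + 1` belongs to the set `s`. -/
def HasInner (s : Finset (Fin M)) (j : ℕ) : Prop := ∃ q ∈ s, (q : ℕ) = 2 * j + 1

/-- The denominator `p_1 + … + p_i - i`. -/
noncomputable def denomOn {n : ℕ} (σ : Fin n → Finset (Fin M)) (i : Fin n) : ℝ :=
  ((∑ j ∈ Finset.univ.filter (fun j => j ≤ i), (σ j).card : ℕ) : ℝ) - ((i : ℕ) + 1)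

theorem denomOn_snoc_castSucc {n : ℕ} (σ : Fin n → Finset (Fin M)) (s : Finset (Fin M))
    (i : Fin n) :
    denomOn (Fin.snoc σ s : Fin (n + 1) → Finset (Fin M)) i.castSucc = denomOn σ i := by
  simp only [denomOn, Finset.sum_filter, Fin.sum_univ_castSucc, Fin.snoc_castSucc, Fin.snoc_last,
    Fin.castSucc_le_castSucc_iff, Fin.val_castSucc, (Fin.castSucc_lt_last i).not_ge, if_false,
    add_zero]

theorem denomOn_last {n : ℕ} {U : Finset (Fin M)} {σ : Fin (n + 1) → Finset (Fin M)}
    (h : σ ∈ familiesOn (n + 1) U) : denomOn σ (Fin.last n) = U.card - (n + 1) := by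
  simp [denomOn, Fin.le_last, card_eq_of_mem_familiesOn h]

/-- Extension of `ν` by `κ` beyond `n`. -/
def extendBy {n : ℕ} {α : Type*} (ν : Fin n → α) (κ : ℕ → α) (j : ℕ) : α :=
  if h : j < n then ν ⟨j, h⟩ else κ j

/-- Once the last set is split off, the index of its pair joins the fixed indices of the shorter
family. -/
theorem extendBy_snoc {n : ℕ} {α : Type*} (ν : Fin n → α) (c : α) (κ : ℕ → α) :
    extendBy (Fin.snoc ν c : Fin (n + 1) → α) κ = extendBy ν (Function.update κ n c) := by
  funext j
  rcases lt_trichotomy j n with h | rfl | h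
  · have : (⟨j, h.trans (Nat.lt_succ_self n)⟩ : Fin (n + 1)) = Fin.castSucc ⟨j, h⟩ := rfl
    simp only [extendBy, h, h.trans (Nat.lt_succ_self n), dif_pos, this, Fin.snoc_castSucc]
  · have : (⟨j, Nat.lt_succ_self j⟩ : Fin (j + 1)) = Fin.last j := rfl
    simp only [extendBy, Nat.lt_succ_self, dif_pos, this, Fin.snoc_last, lt_irrefl, dif_neg,
      not_false_eq_true, Function.update_self]
  · have h1 : ¬ j < n + 1 := by omega
    have h2 : ¬ j < n := by omega
    simp only [extendBy, h1, h2, dif_neg, not_false_eq_true, Function.update_of_ne h.ne']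

theorem sum_filter_snoc {α β : Type*} [Fintype α] [AddCommMonoid β] {n : ℕ}
    {P : (Fin (n + 1) → α) → Prop} [DecidablePred P] {Q : α → Prop} [DecidablePred Q]
    {P' : α → (Fin n → α) → Prop} [∀ s, DecidablePred (P' s)]
    (h : ∀ σ s, P (Fin.snoc σ s : Fin (n + 1) → α) ↔ Q s ∧ P' s σ) (f : (Fin (n + 1) → α) → β) :
    ∑ σ with P σ, f σ = ∑ s with Q s, ∑ σ with P' s σ, f (Fin.snoc σ s : Fin (n + 1) → α) := by
  rw [Finset.sum_filter, ← (Fin.snocEquiv fun _ => α).sum_comp, Fintype.sum_prod_type,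
    Finset.sum_filter]
  refine Finset.sum_congr rfl fun s _ => ?_
  rw [Finset.sum_filter]
  by_cases hs : Q s
  · rw [if_pos hs]
    refine Finset.sum_congr rfl fun σ _ => if_congr ((h σ s).trans ?_) rfl rfl
    simp [hs]
  · rw [if_neg hs]
    exact Finset.sum_eq_zero fun σ _ => if_neg fun hP => hs ((h σ s).1 hP).1

variable {R : Type*} [Ring R] [Algebra ℝ R] [NeZero d]

/-- The index values are pinned for the pairs of labels inside one set. -/
def IsPinned {n : ℕ} (σ : Fin n → Finset (Fin M)) (ν : Fin n → Fin d) : Prop :=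
  ∀ j, HasInner (σ j) j → ν j = 0

theorem isPinned_snoc {n : ℕ} (σ : Fin n → Finset (Fin M)) (s : Finset (Fin M))
    (ν : Fin n → Fin d) (c : Fin d) :
    IsPinned (Fin.snoc σ s : Fin (n + 1) → Finset (Fin M)) (Fin.snoc ν c : Fin (n + 1) → Fin d)
      ↔ (HasInner s n → c = 0) ∧ IsPinned σ ν := by
  simp only [IsPinned, Fin.forall_fin_succ', Fin.snoc_castSucc, Fin.snoc_last, Fin.val_castSucc,
    Fin.val_last, and_comm]

open Classical in
/-- The sum over all families of `n` sets with union `U`, with the indices of the labels `≥ 2n`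
fixed by `κ`. -/
noncomputable def familySum (Om : List (ℕ × Fin d) → R) (n : ℕ) (U : Finset (Fin M))
    (κ : ℕ → Fin d) : R :=
  ∑ σ with σ ∈ familiesOn n U, ∑ ν : Fin n → Fin d with IsPinned σ ν,
    ((List.finRange n).reverse.map fun i =>
      (denomOn σ i)⁻¹ • Om (labelList (σ i) (extendBy ν κ))).prod

open Classical in
theorem familySum_zero (Om : List (ℕ × Fin d) → R) (U : Finset (Fin M)) (κ : ℕ → Fin d) :
    familySum Om 0 U κ = if U = ∅ then 1 else 0 := by
  have h : ∀ σ : Fin 0 → Finset (Fin M), σ ∈ familiesOn 0 U ↔ U = ∅ := by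
    intro σ
    simp [familiesOn, Finset.eq_empty_iff_forall_notMem]
  simp only [familySum, h]
  by_cases hU : U = ∅ <;> simp [hU, IsPinned]

open Classical in
-- The last set gives the leftmost factor. Its labels are all at least 2n, so that factor sees only
-- κ and the new index c, and the remaining sets form a family on the complement.
theorem familySum_succ (Om : List (ℕ × Fin d) → R) (n : ℕ) (U : Finset (Fin M))
    (κ : ℕ → Fin d) :
    familySum Om (n + 1) U κ
      = ∑ s with s ⊆ U ∧ IsLastMember n s, ∑ c with HasInner s n → c = 0,
          (((U.card : ℝ) - (n + 1))⁻¹ • Om (labelList s (Function.update κ n c)))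
            * familySum Om n (U \ s) (Function.update κ n c) := by
  rw [familySum, sum_filter_snoc fun σ s => snoc_mem_familiesOn]
  refine Finset.sum_congr rfl fun s hs => ?_
  have hs := (Finset.mem_filter.1 hs).2
  simp only [familySum, Finset.mul_sum]
  rw [Finset.sum_comm (s := Finset.univ.filter fun c => HasInner s n → c = 0)]
  refine Finset.sum_congr rfl fun σ hσ => ?_
  have hm := snoc_mem_familiesOn.2 ⟨hs, (Finset.mem_filter.1 hσ).2⟩
  rw [sum_filter_snoc fun ν c => isPinned_snoc σ s ν c]
  refine Finset.sum_congr rfl fun c _ => Finset.sum_congr rfl fun ν _ => ?_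
  rw [List.finRange_succ_last, List.reverse_append, List.reverse_singleton, List.singleton_append,
    List.map_cons, List.prod_cons, ← List.map_reverse, List.map_map, denomOn_last hm]
  simp only [Fin.snoc_last, extendBy_snoc]
  congr 3
  · refine labelList_congr fun q hq => ?_
    have : ¬ (q : ℕ) / 2 < n := by
      have := hs.2.1 q hq
      omega
    simp [extendBy, this]
  · funext i
    simp only [Function.comp_apply, denomOn_snoc_castSucc, Fin.snoc_castSucc]

end Families

/-! ### The sum over families solves the recurrence -/

/-- A nonempty last set must contain a, so three kinds remain, matching the three terms of the
recurrence. -/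
theorem sum_isLastMember {M n : ℕ} {β : Type*} [AddCommMonoid β] {U T : Finset (Fin M)}
    {a b : Fin M} (ha : (a : ℕ) = 2 * n) (hb : (b : ℕ) = 2 * n + 1)
    (hT : ∀ q ∈ T, 2 * (n + 1) ≤ (q : ℕ))
    (hU : U.filter (fun q : Fin M => 2 * n ≤ (q : ℕ)) = insert a (insert b T))
    [DecidablePred fun s : Finset (Fin M) => s ⊆ U ∧ IsLastMember n s]
    (g : Finset (Fin M) → β) :
    ∑ s with s ⊆ U ∧ IsLastMember n s, g s
      = g ∅ + ∑ S ∈ T.powerset, g (insert a S)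
        + ∑ S ∈ T.powerset, g (insert a (insert b S)) := by
  have hab : a ≠ b := fun h => by rw [h] at ha; omega
  have haT : a ∉ T := fun h => by have := hT a h; omega
  have hbT : b ∉ T := fun h => by have := hT b h; omega
  have e : (Finset.univ.filter fun s => s ⊆ U ∧ IsLastMember n s)
      = (insert a (insert b T)).powerset.filter fun s => a ∈ s ∨ s = ∅ := by
    ext s
    simp only [Finset.mem_filter, Finset.mem_univ, true_and, Finset.mem_powerset, ← hU,
      Finset.subset_iff, IsLastMember]
    have : (∃ q ∈ s, (q : ℕ) = 2 * n) ↔ a ∈ s := by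
      constructor
      · rintro ⟨q, hq, h⟩
        rwa [← Fin.ext (h.trans ha.symm)]
      · exact fun h => ⟨a, h, ha⟩
    rw [this]
    constructor
    · exact fun h => ⟨fun q hq => ⟨h.1 hq, h.2.1 q hq⟩, h.2.2⟩
    · exact fun h => ⟨fun q hq => (h.1 hq).1, fun q hq => (h.1 hq).2, h.2⟩
  rw [e, Finset.sum_filter, Finset.sum_powerset_insert (by simp [hab, haT]),
    Finset.sum_powerset_insert hbT, Finset.sum_powerset_insert hbT]
  have h1 : ∑ S ∈ T.powerset, (if a ∈ S ∨ S = ∅ then g S else 0) = g ∅ := by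
    rw [Finset.sum_eq_single ∅]
    · simp
    · intro S hS hne
      exact if_neg fun h => h.elim (fun h => haT (Finset.mem_powerset.1 hS h)) hne
    · simp
  have h2 : ∑ S ∈ T.powerset, (if a ∈ insert b S ∨ insert b S = ∅ then g (insert b S) else 0)
      = 0 := by
    refine Finset.sum_eq_zero fun S hS => if_neg ?_
    rintro (h | h)
    · exact haT (Finset.mem_powerset.1 hS ((Finset.mem_insert.1 h).resolve_left hab))
    · exact Finset.insert_ne_empty _ _ h
  simp only [h1, h2, Finset.mem_insert_self, true_or, if_true, add_zero, add_assoc]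

namespace JetAlgebra

variable {d M : ℕ} {A R : Type*} [Ring A] [Algebra ℝ A] [Ring R] [Algebra ℝ R]
  (J : JetAlgebra d A R)

theorem iterD_one {γ : List (Fin d)} (h : γ ≠ []) : J.iterD γ 1 = 0 := by
  induction γ with
  | nil => exact absurd rfl h
  | cons μ γ ih =>
    cases γ with
    | nil => exact J.D_one μ
    | cons ν γ => rw [iterD_cons, ih (List.cons_ne_nil _ _), map_zero]

theorem iterD_D (γ : List (Fin d)) (μ : Fin d) (f : A) :
    J.iterD γ (J.D μ f) = J.D μ (J.iterD γ f) := by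
  rw [← iterD_cons, ← J.iterD_perm (List.perm_append_singleton μ γ), iterD_append]
  rfl

/-- The derivative with respect to the indices of a set of labels. -/
def labelD (s : Finset (Fin M)) (κ : ℕ → Fin d) : A →ₗ[ℝ] A :=
  J.iterD ((labelList s κ).map Prod.snd)

theorem labelD_insert {s : Finset (Fin M)} {a : Fin M} (h : a ∉ s) (κ : ℕ → Fin d) (f : A) :
    J.labelD (insert a s) κ f = J.labelD s κ (J.D (κ ((a : ℕ) / 2)) f) := by
  rw [labelD, J.iterD_perm ((labelList_insert_perm h κ).map _), labelD, iterD_D]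
  rfl

/-- Labels keep derivatives apart even when their indices coincide, so the Leibniz rule runs over
subsets without multiplicities. -/
theorem labelD_mul (s : Finset (Fin M)) (κ : ℕ → Fin d) (f g : A) :
    J.labelD s κ (f * g)
      = ∑ S ∈ s.powerset, J.labelD S κ f * J.labelD (s \ S) κ g := by
  induction s using Finset.induction_on generalizing f g with
  | empty => simp [labelD]
  | insert a s ha ih =>
    rw [labelD_insert J ha, J.leibniz, map_add, ih, ih, Finset.sum_powerset_insert ha, add_comm]
    congr 1 <;> refine Finset.sum_congr rfl fun S hS => ?_
    · have haS : a ∉ S := fun h => ha (Finset.mem_powerset.1 hS h)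
      rw [Finset.insert_sdiff_of_notMem _ haS, labelD_insert J (by simp [ha])]
    · have haS : a ∉ S := fun h => ha (Finset.mem_powerset.1 hS h)
      rw [labelD_insert J haS, Finset.insert_sdiff_insert, Finset.sdiff_insert_of_notMem ha]

theorem labelD_congr {s : Finset (Fin M)} {κ κ' : ℕ → Fin d}
    (h : ∀ q ∈ s, κ ((q : ℕ) / 2) = κ' ((q : ℕ) / 2)) :
    (J.labelD s κ : A →ₗ[ℝ] A) = J.labelD s κ' := by
  rw [labelD, labelD, labelList_congr h]

/-- Both sides obey the same recursion in n. Labels of `U` from 2n on are derivatives inherited from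
later sets, which is why general `U` and κ are needed. -/
theorem familySum_eq_ev [NeZero d] {w : Fin d → A} {f : A} {b : ℕ → A} (hb0 : b 0 = 1)
    (hb : ∀ n : ℕ, ((n : ℝ) + 1) • b (n + 1) + J.euler (b (n + 1))
      = ∑ μ, (J.D μ (J.D μ (b n)) + (2 : ℝ) • (w μ * J.D μ (b n))) + J.potential w f * b n)
    {Om : List (ℕ × Fin d) → R} (hnil : Om [] = 1)
    (hoff : ∀ n c l, (∀ p ∈ l, p.1 ≠ n) →
      Om ((n, c) :: l) = (2 : ℝ) • J.ev (J.iterD (l.map Prod.snd) (w c)))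
    (hdiag : ∀ n c c' l, Om ((n, c) :: (n, c') :: l)
      = J.ev (J.iterD (l.map Prod.snd) (J.potential w f)))
    (n : ℕ) (hn : 2 * n ≤ M) (U : Finset (Fin M)) (hU : ∀ q : Fin M, (q : ℕ) < 2 * n → q ∈ U)
    (κ : ℕ → Fin d) :
    familySum Om n U κ
      = J.ev (J.labelD (U.filter fun q : Fin M => 2 * n ≤ (q : ℕ)) κ (b n)) := by
  classical
  induction n generalizing U κ with
  | zero =>
    rw [familySum_zero, hb0]
    simp only [Nat.mul_zero, Nat.zero_le, Finset.filter_true]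
    by_cases h : U = ∅
    · simp [h, labelD]
    · have : (labelList U κ).map Prod.snd ≠ [] := by
        simpa [labelList, ← List.length_eq_zero_iff] using h
      rw [if_neg h, labelD, J.iterD_one this, map_zero]
  | succ n ih =>
    obtain ⟨a, ha⟩ : ∃ a : Fin M, (a : ℕ) = 2 * n := ⟨⟨2 * n, by omega⟩, rfl⟩
    obtain ⟨b', hb'⟩ : ∃ b' : Fin M, (b' : ℕ) = 2 * n + 1 := ⟨⟨2 * n + 1, by omega⟩, rfl⟩
    set T := U.filter fun q : Fin M => 2 * (n + 1) ≤ (q : ℕ) with hTdef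
    have hT : ∀ q ∈ T, 2 * (n + 1) ≤ (q : ℕ) := fun q hq => (Finset.mem_filter.1 hq).2
    have hab : a ≠ b' := fun h => by rw [h] at ha; omega
    have haT : a ∉ T := fun h => by have := hT a h; omega
    have hbT : b' ∉ T := fun h => by have := hT b' h; omega
    have hUT : U.filter (fun q : Fin M => 2 * n ≤ (q : ℕ)) = insert a (insert b' T) := by
      ext q
      simp only [hTdef, Finset.mem_filter, Finset.mem_insert, Fin.ext_iff, ha, hb']
      have := hU q
      constructor
      · rintro ⟨h1, h2⟩
        by_cases h : (q : ℕ) < 2 * (n + 1)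
        · omega
        · exact Or.inr (Or.inr ⟨h1, by omega⟩)
      · rintro (h | h | h)
        · exact ⟨this (by omega), by omega⟩
        · exact ⟨this (by omega), by omega⟩
        · exact ⟨h.1, by omega⟩
    have hUs : ∀ s, (U \ s).filter (fun q : Fin M => 2 * n ≤ (q : ℕ))
        = insert a (insert b' T) \ s := by
      intro s
      rw [← hUT]
      ext q
      simp only [Finset.mem_filter, Finset.mem_sdiff]
      tauto
    -- All 2(n + 1) labels below `T` lie in `U`. The denominator is therefore the value of n + 1 +
    -- x·∂ on derivatives of order |T|.
    have hcard : (U.card : ℝ) - ((n : ℝ) + 1) = (n : ℝ) + 1 + T.card := by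
      have h1 := Finset.card_filter_add_card_filter_not
        (s := U) (fun q : Fin M => 2 * (n + 1) ≤ (q : ℕ))
      have h2 : (U.filter fun q : Fin M => ¬ 2 * (n + 1) ≤ (q : ℕ))
          = Finset.univ.filter fun q : Fin M => (q : ℕ) < 2 * (n + 1) := by
        ext q
        simp only [Finset.mem_filter, Finset.mem_univ, true_and, not_le]
        exact ⟨fun h => h.2, fun h => ⟨hU q h, h⟩⟩
      rw [h2, Fin.card_filter_val_lt, min_eq_right hn, ← hTdef] at h1
      rw [← h1]
      push_cast
      ring
    have hκ : ∀ c, ∀ S ⊆ T, (J.labelD S (Function.update κ n c) : A →ₗ[ℝ] A) = J.labelD S κ := by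
      intro c S hS
      refine J.labelD_congr fun q hq => ?_
      have := hT q (hS hq)
      rw [Function.update_of_ne (by omega)]
    have hfst : ∀ S ⊆ T, ∀ κ : ℕ → Fin d, ∀ p ∈ labelList S κ, p.1 ≠ n := by
      intro S hS κ p hp
      simp only [labelList, List.mem_map, Finset.mem_sort] at hp
      obtain ⟨q, hq, rfl⟩ := hp
      have := hT q (hS hq)
      simp only [ne_eq]
      omega
    have hih : ∀ s : Finset (Fin M), (∀ q ∈ s, 2 * n ≤ (q : ℕ)) → ∀ κ, familySum Om n (U \ s) κ
        = J.ev (J.labelD (insert a (insert b' T) \ s) κ (b n)) := by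
      intro s hs κ
      rw [ih (by omega) _ (fun q hq => Finset.mem_sdiff.2 ⟨hU q (by omega), fun h => ?_⟩), hUs]
      have := hs q h
      omega
    have ha2 : (a : ℕ) / 2 = n := by omega
    have hb2 : (b' : ℕ) / 2 = n := by omega
    have hbS : ∀ S ⊆ T, b' ∉ S := fun S hS h => hbT (hS h)
    set r : ℝ := ((U.card : ℝ) - ((n : ℝ) + 1))⁻¹ with hr
    -- the three kinds of last members
    have h1 : ∑ c with HasInner (∅ : Finset (Fin M)) n → c = 0,
        (r • Om (labelList (∅ : Finset (Fin M)) (Function.update κ n c)))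
            * familySum Om n (U \ ∅) (Function.update κ n c)
        = r • J.ev (J.labelD T κ (∑ μ, J.D μ (J.D μ (b n)))) := by
      have hin : ¬ HasInner (∅ : Finset (Fin M)) n := by simp [HasInner]
      simp only [hin, false_imp_iff, Finset.filter_true, labelList_empty, hnil, map_sum,
        Finset.smul_sum]
      refine Finset.sum_congr rfl fun c _ => ?_
      rw [hih ∅ (by simp), Finset.sdiff_empty, labelD_insert J (by simp [hab, haT]),
        labelD_insert J hbT, ha2, hb2, Function.update_self, hκ c T subset_rfl, smul_mul_assoc,
        one_mul]
    -- The labels in `S` differentiate w_c; b' stays behind and becomes the ∂_c acting on b_n.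
    have h2 : ∑ S ∈ T.powerset, ∑ c with HasInner (insert a S) n → c = 0,
        (r • Om (labelList (insert a S) (Function.update κ n c)))
            * familySum Om n (U \ insert a S) (Function.update κ n c)
        = r • J.ev (J.labelD T κ (∑ μ, (2 : ℝ) • (w μ * J.D μ (b n)))) := by
      simp only [map_sum, map_smul, labelD_mul, map_mul, Finset.smul_sum]
      rw [Finset.sum_comm]
      refine Finset.sum_congr rfl fun S hS => ?_
      have hS := Finset.mem_powerset.1 hS
      have hin : ¬ HasInner (insert a S) n := by
        rintro ⟨q, hq, h⟩
        rw [← hb'] at h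
        rw [Fin.ext h] at hq
        exact hbS S hS ((Finset.mem_insert.1 hq).resolve_left hab.symm)
      simp only [hin, false_imp_iff, Finset.filter_true]
      refine Finset.sum_congr rfl fun c _ => ?_
      have hlt : ∀ q ∈ S, a < q := fun q hq => by
        have := hT q (hS hq)
        rw [Fin.lt_def]
        omega
      rw [hih, labelList_insert_min hlt, ha2, Function.update_self, hoff n c _ (hfst S hS _),
        Finset.insert_sdiff_insert, Finset.sdiff_insert_of_notMem (by simp [hab, haT]),
        Finset.insert_sdiff_of_notMem _ (hbS S hS),
        labelD_insert J (fun h => hbT (Finset.mem_sdiff.1 h).1), hb2, Function.update_self,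
        hκ c _ Finset.sdiff_subset, ← labelD, hκ c S hS, smul_mul_assoc, smul_mul_assoc]
      intro q hq
      rcases Finset.mem_insert.1 hq with rfl | hq
      · exact ha.ge
      · have := hT q (hS hq)
        omega
    -- The pinning c = 0 leaves one term, since the sum over the pair's index is inside P.
    have h3 : ∑ S ∈ T.powerset, ∑ c with HasInner (insert a (insert b' S)) n → c = 0,
        (r • Om (labelList (insert a (insert b' S)) (Function.update κ n c)))
            * familySum Om n (U \ insert a (insert b' S)) (Function.update κ n c)
        = r • J.ev (J.labelD T κ (J.potential w f * b n)) := by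
      simp only [map_sum, labelD_mul, map_mul, Finset.smul_sum]
      refine Finset.sum_congr rfl fun S hS => ?_
      have hS := Finset.mem_powerset.1 hS
      have hin : HasInner (insert a (insert b' S)) n := ⟨b', by simp, hb'⟩
      simp only [hin, true_imp_iff, Finset.filter_eq', Finset.mem_univ, if_true,
        Finset.sum_singleton]
      have hlt : ∀ q ∈ S, b' < q := fun q hq => by
        have := hT q (hS hq)
        rw [Fin.lt_def]
        omega
      have hlt' : ∀ q ∈ insert b' S, a < q := fun q hq => by
        rcases Finset.mem_insert.1 hq with rfl | hq
        · rw [Fin.lt_def]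
          omega
        · have := hT q (hS hq)
          rw [Fin.lt_def]
          omega
      rw [hih, labelList_insert_min hlt', labelList_insert_min hlt, ha2, hb2, hdiag,
        Finset.insert_sdiff_insert, Finset.sdiff_insert_of_notMem (by simp [hab, haT]),
        Finset.insert_sdiff_insert, Finset.sdiff_insert_of_notMem hbT,
        hκ 0 _ Finset.sdiff_subset, ← labelD, hκ 0 S hS, smul_mul_assoc]
      intro q hq
      rcases Finset.mem_insert.1 hq with rfl | hq
      · exact ha.ge
      · have := hlt q
        rcases Finset.mem_insert.1 hq with rfl | hq
        · omega
        · have := hT q (hS hq)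
          omega
    rw [familySum_succ, sum_isLastMember ha hb' hT hUT, h1, h2, h3, ← smul_add, ← smul_add,
      ← map_add, ← map_add, ← map_add, ← map_add, ← Finset.sum_add_distrib, ← hb, map_add,
      map_smul, map_add, map_smul]
    have hl : ((labelList T κ).map Prod.snd).length = T.card := by
      rw [List.length_map, labelList, List.length_map, Finset.length_sort]
    rw [labelD, J.ev_iterD_euler, hl, ← add_smul, smul_smul, hr, hcard,
      inv_mul_cancel₀ (add_pos_of_pos_of_nonneg n.cast_add_one_pos (Nat.cast_nonneg _)).ne',
      one_smul]

end JetAlgebra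

/-! ### The heat recurrence in the Fock–Schwinger gauge. -/

namespace JetAlgebra

variable {d : ℕ} {A R : Type*} [Ring A] [Algebra ℝ A] [Ring R] [Algebra ℝ R]
  (J : JetAlgebra d A R) {B : Fin d → A} {g : Aˣ}

theorem gauge_radial (h : ∑ μ, J.X μ * (J.D μ g + B μ * g) = 0) :
    ∑ μ, J.X μ * J.gauge B g μ = 0 := by
  have := congrArg (fun z => (↑g⁻¹ : A) * z) h
  simpa only [gauge, Finset.mul_sum, mul_zero, ← mul_assoc, J.X_comm] using this

/-- The radial covariant derivative loses its connection term, as x·w = 0, and (∂_μ + w_μ)² is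
expanded. -/
theorem heat_recurrence_gauge {v : A} {a a' : A} {n : ℝ}
    (hg : ∑ μ, J.X μ * (J.D μ g + B μ * g) = 0)
    (h : n • a' + ∑ μ, J.X μ * (J.D μ a' + B μ * a')
      = ∑ μ, (J.D μ (J.D μ a + B μ * a) + B μ * (J.D μ a + B μ * a)) + v * a) :
    n • (↑g⁻¹ * a') + J.euler (↑g⁻¹ * a')
      = ∑ μ, (J.D μ (J.D μ (↑g⁻¹ * a)) + (2 : ℝ) • (J.gauge B g μ * J.D μ (↑g⁻¹ * a)))
        + J.potential (J.gauge B g) (↑g⁻¹ * v * g) * (↑g⁻¹ * a) := by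
  obtain ⟨b, rfl⟩ : ∃ b, a = g * b := ⟨↑g⁻¹ * a, by simp⟩
  obtain ⟨b', rfl⟩ : ∃ b', a' = g * b' := ⟨↑g⁻¹ * a', by simp⟩
  have hw := J.gauge_radial hg
  simp only [D_mul_gauge] at h
  generalize J.gauge B g = w at *
  have e : ∑ μ, J.X μ * (g * (J.D μ b' + w μ * b')) = g * J.euler b' := by
    simp only [euler_apply, Finset.mul_sum, ← mul_assoc, J.X_comm _ (g : A)]
    simp only [mul_assoc, mul_add, Finset.sum_add_distrib]
    rw [add_eq_left]
    simp only [← mul_assoc (J.X _), ← Finset.sum_mul, ← Finset.mul_sum, hw, zero_mul, mul_zero]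
  rw [e, ← mul_smul_comm, ← mul_add, ← Finset.mul_sum, ← mul_assoc v] at h
  have h2 := congrArg (fun z => (↑g⁻¹ : A) * z) h
  simp only [mul_add, ← mul_assoc, Units.inv_mul, one_mul] at h2
  simp only [← mul_assoc, Units.inv_mul, one_mul]
  rw [h2, potential, add_mul, ← add_assoc, Finset.sum_mul, ← Finset.sum_add_distrib]
  congr 1
  refine Finset.sum_congr rfl fun μ _ => ?_
  rw [map_add, J.leibniz, two_smul]
  noncomm_ring

end JetAlgebra

/-! ### Smooth functions on an open set -/

section Smooth

variable {d : ℕ} {R : Type*} [NormedRing R] [NormedAlgebra ℝ R] {W : Set (Eucl d)}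

theorem pd_eqOn (hW : IsOpen W) {f g : Eucl d → R} (h : Set.EqOn f g W) (μ : Fin d) :
    Set.EqOn (pd μ f) (pd μ g) W := by
  intro z hz
  have : f =ᶠ[nhds z] g := Filter.mem_of_superset (hW.mem_nhds hz) h
  rw [pd, pd, this.fderiv_eq]

theorem contDiffOn_pd (hW : IsOpen W) {f : Eucl d → R} (hf : ContDiffOn ℝ ∞ f W) (μ : Fin d) :
    ContDiffOn ℝ ∞ (pd μ f) W :=
  (hf.fderiv_of_isOpen hW (m := ∞) le_rfl).clm_apply contDiffOn_const

theorem differentiableAt_of_contDiffOn (hW : IsOpen W) {f : Eucl d → R}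
    (hf : ContDiffOn ℝ ∞ f W) {z : Eucl d} (hz : z ∈ W) : DifferentiableAt ℝ f z :=
  (hf.contDiffAt (hW.mem_nhds hz)).differentiableAt (by simp)

theorem pd_mul (hW : IsOpen W) {f g : Eucl d → R} (hf : ContDiffOn ℝ ∞ f W)
    (hg : ContDiffOn ℝ ∞ g W) (μ : Fin d) {z : Eucl d} (hz : z ∈ W) :
    pd μ (fun z => f z * g z) z = pd μ f z * g z + f z * pd μ g z := by
  rw [pd, fderiv_fun_mul' (differentiableAt_of_contDiffOn hW hf hz)
    (differentiableAt_of_contDiffOn hW hg hz)]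
  simp [pd, add_comm]

theorem pd_comm (hW : IsOpen W) {f : Eucl d → R} (hf : ContDiffOn ℝ ∞ f W) (μ ν : Fin d)
    {z : Eucl d} (hz : z ∈ W) : pd μ (pd ν f) z = pd ν (pd μ f) z := by
  have hz' := hW.mem_nhds hz
  have h2 : DifferentiableAt ℝ (fderiv ℝ f) z :=
    ((hf.fderiv_of_isOpen hW (m := ∞) le_rfl).contDiffAt hz').differentiableAt (by simp)
  have key : ∀ u e : Eucl d, fderiv ℝ (fun z => fderiv ℝ f z u) z e
      = fderiv ℝ (fderiv ℝ f) z e u := by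
    intro u e
    rw [fderiv_clm_apply h2 (differentiableAt_const u)]
    simp
  have hs : IsSymmSndFDerivAt ℝ f z := (hf.contDiffAt hz').isSymmSndFDerivAt (by
    rw [minSmoothness_of_isRCLikeNormedField]
    exact WithTop.coe_le_coe.2 (le_top : (2 : ℕ∞) ≤ ⊤))
  change fderiv ℝ (fun z => fderiv ℝ f z _) z _ = fderiv ℝ (fun z => fderiv ℝ f z _) z _
  rw [key, key, hs.eq]

variable (R W) in
/-- The algebra of smooth functions on the set `W`. -/
def smoothFn : Subalgebra ℝ (W → R) where
  carrier := {f | ∃ g : Eucl d → R, ContDiffOn ℝ ∞ g W ∧ ∀ z : W, f z = g z}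
  mul_mem' := by
    rintro _ _ ⟨f, hf, hf'⟩ ⟨g, hg, hg'⟩
    exact ⟨fun z => f z * g z, hf.mul hg, fun z => by simp [hf', hg']⟩
  add_mem' := by
    rintro _ _ ⟨f, hf, hf'⟩ ⟨g, hg, hg'⟩
    exact ⟨fun z => f z + g z, hf.add hg, fun z => by simp [hf', hg']⟩
  algebraMap_mem' r := ⟨fun _ => algebraMap ℝ R r, contDiffOn_const, fun _ => rfl⟩

/-- The restriction of a smooth function to `W`. -/
def restr (f : Eucl d → R) (hf : ContDiffOn ℝ ∞ f W) : smoothFn R W :=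
  ⟨fun z => f z, f, hf, fun _ => rfl⟩

theorem restr_eq {f g : Eucl d → R} {hf : ContDiffOn ℝ ∞ f W} {hg : ContDiffOn ℝ ∞ g W}
    (h : ∀ z ∈ W, f z = g z) : restr f hf = restr g hg :=
  Subtype.ext (funext fun z => h z z.2)

theorem eqOn_of_restr_eq {f g : Eucl d → R} {hf : ContDiffOn ℝ ∞ f W}
    {hg : ContDiffOn ℝ ∞ g W} (h : restr f hf = restr g hg) : Set.EqOn f g W :=
  fun z hz => congrFun (congrArg Subtype.val h) ⟨z, hz⟩

theorem exists_restr (F : smoothFn R W) : ∃ f hf, F = restr f hf := by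
  obtain ⟨F, f, hf, h⟩ := F
  exact ⟨f, hf, Subtype.ext (funext h)⟩

theorem restr_add {f g : Eucl d → R} (hf : ContDiffOn ℝ ∞ f W) (hg : ContDiffOn ℝ ∞ g W) :
    restr f hf + restr g hg = restr (fun z => f z + g z) (hf.add hg) := rfl

theorem restr_mul {f g : Eucl d → R} (hf : ContDiffOn ℝ ∞ f W) (hg : ContDiffOn ℝ ∞ g W) :
    restr f hf * restr g hg = restr (fun z => f z * g z) (hf.mul hg) := rfl

theorem restr_smul (r : ℝ) {f : Eucl d → R} (hf : ContDiffOn ℝ ∞ f W) :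
    r • restr f hf = restr (fun z => r • f z) (hf.const_smul r) := rfl

/-- The partial derivative on smooth functions. -/
noncomputable def smoothPd (hW : IsOpen W) (μ : Fin d) (F : smoothFn R W) : smoothFn R W :=
  restr (pd μ (exists_restr F).choose) (contDiffOn_pd hW (exists_restr F).choose_spec.choose μ)

/-- On an open set the derivative depends only on the restriction, so the chosen extension is
immaterial. -/
theorem smoothPd_restr (hW : IsOpen W) (μ : Fin d) {f : Eucl d → R} (hf : ContDiffOn ℝ ∞ f W) :
    smoothPd hW μ (restr f hf) = restr (pd μ f) (contDiffOn_pd hW hf μ) :=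
  restr_eq <| pd_eqOn hW
    (eqOn_of_restr_eq (exists_restr (restr f hf)).choose_spec.choose_spec.symm) μ

theorem contDiff_coord (R : Type*) [NormedRing R] [NormedAlgebra ℝ R] (y : Eucl d) (μ : Fin d) :
    ContDiff ℝ ∞ fun z : Eucl d => algebraMap ℝ R (z μ - y μ) :=
  (algebraMapCLM ℝ R).contDiff.comp
    ((EuclideanSpace.proj (𝕜 := ℝ) μ).contDiff.sub contDiff_const)

/-- The algebra of smooth functions on an open set, with the coordinates centred at `y`. -/
noncomputable def smoothJet (R : Type*) [NormedRing R] [NormedAlgebra ℝ R] (hW : IsOpen W)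
    {y : Eucl d} (hy : y ∈ W) : JetAlgebra d (smoothFn R W) R where
  D μ :=
    { toFun := smoothPd hW μ
      map_add' := by
        intro F G
        obtain ⟨f, hf, rfl⟩ := exists_restr F
        obtain ⟨g, hg, rfl⟩ := exists_restr G
        rw [restr_add, smoothPd_restr, smoothPd_restr, smoothPd_restr, restr_add]
        refine restr_eq fun z hz => ?_
        rw [pd, fderiv_fun_add (differentiableAt_of_contDiffOn hW hf hz)
          (differentiableAt_of_contDiffOn hW hg hz)]
        rfl
      map_smul' := by
        intro r F
        obtain ⟨f, hf, rfl⟩ := exists_restr F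
        rw [restr_smul, smoothPd_restr, smoothPd_restr, RingHom.id_apply, restr_smul]
        refine restr_eq fun z hz => ?_
        rw [pd, fderiv_fun_const_smul (differentiableAt_of_contDiffOn hW hf hz)]
        rfl }
  leibniz := by
    intro μ F G
    obtain ⟨f, hf, rfl⟩ := exists_restr F
    obtain ⟨g, hg, rfl⟩ := exists_restr G
    simp only [LinearMap.coe_mk, AddHom.coe_mk, restr_mul, smoothPd_restr, restr_add]
    exact restr_eq fun z hz => pd_mul hW hf hg μ hz
  D_comm := by
    intro μ ν F
    obtain ⟨f, hf, rfl⟩ := exists_restr F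
    simp only [LinearMap.coe_mk, AddHom.coe_mk, smoothPd_restr]
    exact restr_eq fun z hz => pd_comm hW hf μ ν hz
  X μ := restr (fun z => algebraMap ℝ R (z μ - y μ)) (contDiff_coord R y μ).contDiffOn
  X_comm := by
    intro μ F
    obtain ⟨f, hf, rfl⟩ := exists_restr F
    rw [restr_mul, restr_mul]
    exact restr_eq fun z _ => Algebra.commutes _ _
  D_X := by
    intro μ ν
    have e : ∀ z : Eucl d, pd μ (fun z : Eucl d => algebraMap ℝ R (z ν - y ν)) z
        = if μ = ν then 1 else 0 := by
      intro z
      have h : HasFDerivAt (fun z : Eucl d => algebraMap ℝ R (z ν - y ν))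
          ((algebraMapCLM ℝ R).comp (EuclideanSpace.proj (𝕜 := ℝ) ν : Eucl d →L[ℝ] ℝ)) z :=
        (algebraMapCLM ℝ R).hasFDerivAt.comp z
          ((EuclideanSpace.proj (𝕜 := ℝ) ν).hasFDerivAt.sub_const (y ν))
      rw [pd, h.fderiv]
      by_cases hμ : μ = ν
      · simp [hμ]
      · simp [hμ, Ne.symm hμ]
    simp only [LinearMap.coe_mk, AddHom.coe_mk, smoothPd_restr]
    refine Subtype.ext (funext fun z => (e z).trans ?_)
    split_ifs <;> rfl
  ev := (Pi.evalAlgHom ℝ (fun _ : W => R) ⟨y, hy⟩).comp (smoothFn R W).val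
  ev_X := by
    intro μ
    change algebraMap ℝ R (y μ - y μ) = 0
    simp

/-! ### Restriction of the covariant operators -/

section Transfer

variable (hW : IsOpen W) {y : Eucl d} (hy : y ∈ W)

theorem smoothJet_D_restr (μ : Fin d) {f : Eucl d → R} (hf : ContDiffOn ℝ ∞ f W) :
    (smoothJet R hW hy).D μ (restr f hf) = restr (pd μ f) (contDiffOn_pd hW hf μ) :=
  smoothPd_restr hW μ hf

variable {B : Fin d → Eucl d → R} (hB : ∀ μ, ContDiffOn ℝ ∞ (B μ) W)

/-- The restriction of a connection to `W`. -/
def restrConn (μ : Fin d) : smoothFn R W := restr (B μ) (hB μ)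

include hW hB in
theorem contDiffOn_covD {f : Eucl d → R} (hf : ContDiffOn ℝ ∞ f W) (μ : Fin d) :
    ContDiffOn ℝ ∞ (covD B μ f) W :=
  (contDiffOn_pd hW hf μ).add ((hB μ).mul hf)

theorem restr_covD {f : Eucl d → R} (hf : ContDiffOn ℝ ∞ f W) (μ : Fin d) :
    restr (covD B μ f) (contDiffOn_covD hW hB hf μ)
      = (smoothJet R hW hy).D μ (restr f hf) + restrConn hB μ * restr f hf := by
  rw [smoothJet_D_restr]
  rfl

include hW hB in
theorem contDiffOn_nabla {f : Eucl d → R} (hf : ContDiffOn ℝ ∞ f W) (μ : Fin d) :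
    ContDiffOn ℝ ∞ (nabla B μ f) W :=
  (contDiffOn_pd hW hf μ).add (((hB μ).mul hf).sub (hf.mul (hB μ)))

theorem restr_nabla {f : Eucl d → R} (hf : ContDiffOn ℝ ∞ f W) (μ : Fin d) :
    restr (nabla B μ f) (contDiffOn_nabla hW hB hf μ)
      = (smoothJet R hW hy).nab (restrConn hB) μ (restr f hf) := by
  rw [JetAlgebra.nab_apply, smoothJet_D_restr]
  rfl

/-- The existential lets one induction carry smoothness together with the identity that presupposes
it. -/
theorem restr_nablas {f : Eucl d → R} (hf : ContDiffOn ℝ ∞ f W) (α : List (Fin d)) :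
    ∃ h, restr (nablas B f α) h
      = (smoothJet R hW hy).nabs (restrConn hB) (restr f hf) α := by
  induction α with
  | nil => exact ⟨hf, rfl⟩
  | cons μ α ih =>
    obtain ⟨h, e⟩ := ih
    exact ⟨contDiffOn_nabla hW hB h μ, by rw [JetAlgebra.nabs, ← e, ← restr_nabla]; rfl⟩

include hW hB in
theorem contDiffOn_curv (μ ν : Fin d) : ContDiffOn ℝ ∞ (curv B μ ν) W :=
  ((contDiffOn_pd hW (hB ν) μ).sub (contDiffOn_pd hW (hB μ) ν)).add
    (((hB μ).mul (hB ν)).sub ((hB ν).mul (hB μ)))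

theorem restr_nablasF (c : Fin d) (α : List (Fin d)) :
    ∃ h, restr (nablasF B c α) h = (smoothJet R hW hy).nabsF (restrConn hB) c α := by
  induction α with
  | nil => exact ⟨contDiffOn_const, rfl⟩
  | cons μ α ih =>
    cases α with
    | nil =>
      refine ⟨contDiffOn_curv hW hB μ c, ?_⟩
      rw [JetAlgebra.nabsF, JetAlgebra.cur, restrConn, restrConn, smoothJet_D_restr,
        smoothJet_D_restr]
      rfl
    | cons ν α =>
      obtain ⟨h, e⟩ := ih
      exact ⟨contDiffOn_nabla hW hB h μ, by rw [JetAlgebra.nabsF, ← e, ← restr_nabla]; rfl⟩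

end Transfer

end Smooth

/-! ### Assembly of the formula at a point. -/

section Main

variable {d : ℕ} {R : Type*} [NormedRing R] [NormedAlgebra ℝ R]

theorem diagFormula_eq_familySum [NeZero d] (B : Fin d → Eucl d → R) (v : Eucl d → R) (n : ℕ)
    (x : Eucl d) (κ : ℕ → Fin d) :
    diagFormula B v n x
      = familySum (fun l => omega B v l x) n (Finset.univ : Finset (Fin (2 * n))) κ := by
  have e : ∀ ν : Fin n → Fin d, ∀ s : Finset (Fin (2 * n)),
      indexList s ν = labelList s (extendBy ν κ) := by
    intro ν s
    refine List.map_congr_left fun q _ => ?_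
    rw [extendBy, dif_pos (Nat.div_lt_of_lt_mul q.isLt)]
  rw [diagFormula, familySum]
  refine Finset.sum_congr ?_ fun σ _ => Finset.sum_congr ?_ fun ν _ => ?_
  · ext σ
    simp only [families, familiesOn, Finset.mem_filter, Finset.mem_univ, true_and, true_iff,
      Set.mem_ofPred_eq]
  · ext ν
    simp only [indexValues, Finset.mem_filter, Finset.mem_univ, true_and]
    rfl
  · simp only [e]
    rfl

theorem omega_pair_eq (B : Fin d → Eucl d → R) (v : Eucl d → R) (n : ℕ) (c c' : Fin d)
    (l : List (ℕ × Fin d)) (x : Eucl d) :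
    omega B v ((n, c) :: (n, c') :: l) x = omegaDiag B v (l.map Prod.snd).reverse x := by
  simp [omega]

theorem omega_cons_eq (B : Fin d → Eucl d → R) (v : Eucl d → R) (n : ℕ) (c : Fin d)
    (l : List (ℕ × Fin d)) (hl : ∀ p ∈ l, p.1 ≠ n) (x : Eucl d) :
    omega B v ((n, c) :: l) x = omegaOff B (l.map Prod.snd).reverse c x := by
  cases l with
  -- The convention Ω̃^{μ} = 0 agrees with the general expression, whose factor vanishes at k = 1.
  | nil => simp [omega, omegaOff]
  | cons p l =>
    have : n ≠ p.1 := (hl p (by simp)).symm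
    simp [omega, this]

variable [CompleteSpace R] [NeZero d] {Ω : Set (Eucl d)} {B : Fin d → Eucl d → R}
  {v : Eucl d → R} {a : ℕ → Eucl d → Eucl d → R}

/-- The non-recursive formula in a complete normed algebra. -/
theorem IsHeatCoeff.diag_eq (ha : IsHeatCoeff Ω B v a) (hΩ : IsOpen Ω)
    (hB : ∀ μ, ContDiffOn ℝ ∞ (B μ) Ω) (hv : ContDiffOn ℝ ∞ v Ω) (n : ℕ) {y : Eucl d}
    (hy : y ∈ Ω) : a n y y = diagFormula B v n y := by
  -- Only jets at y matter, so invertibility of a₀ on a neighbourhood suffices.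
  set W : Set (Eucl d) := Ω ∩ (fun z => a 0 z y) ⁻¹' {u | IsUnit u} with hWdef
  have hW : IsOpen W := (ha.smooth 0 y hy).continuousOn.isOpen_inter_preimage hΩ Units.isOpen
  have hWΩ : W ⊆ Ω := Set.inter_subset_left
  have hyW : y ∈ W := ⟨hy, by simp [ha.diag_zero y hy]⟩
  have hB' : ∀ μ, ContDiffOn ℝ ∞ (B μ) W := fun μ => (hB μ).mono hWΩ
  have hv' : ContDiffOn ℝ ∞ v W := hv.mono hWΩ
  have ha' : ∀ n, ContDiffOn ℝ ∞ (fun z => a n z y) W := fun n => (ha.smooth n y hy).mono hWΩ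
  have hinv : ContDiffOn ℝ ∞ (fun z => Ring.inverse (a 0 z y)) W := by
    intro z hz
    obtain ⟨u, hu⟩ := hz.2
    have := contDiffAt_ringInverse ℝ (n := ∞) u
    rw [hu] at this
    exact this.comp_contDiffWithinAt z (ha' 0 z hz)
  let g : (smoothFn R W)ˣ :=
    { val := restr (fun z => a 0 z y) (ha' 0)
      inv := restr (fun z => Ring.inverse (a 0 z y)) hinv
      val_inv := Subtype.ext (funext fun z => Ring.mul_inverse_cancel _ z.2.2)
      inv_val := Subtype.ext (funext fun z => Ring.inverse_mul_cancel _ z.2.2) }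
  set J := smoothJet R hW hyW with hJ
  have hg1 : J.ev (g : smoothFn R W) = 1 := ha.diag_zero y hy
  have hg1' : J.ev (↑g⁻¹ : smoothFn R W) = 1 := by
    have h : J.ev ((↑g⁻¹ : smoothFn R W) * g) = 1 := by rw [Units.inv_mul, map_one]
    rwa [map_mul, hg1, mul_one] at h
  set β := restrConn hB' with hβ
  have hX : ∀ {f : Eucl d → R} (hf : ContDiffOn ℝ ∞ f W),
      ∀ z : W, (∑ μ, J.X μ * (J.D μ (restr f hf) + β μ * restr f hf)).val z
        = radialD B y f z := by
    intro f hf z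
    simp only [← restr_covD hW hyW hB' hf, AddSubmonoidClass.coe_finsetSum, Finset.sum_apply,
      radialD, hJ, hβ]
    exact Finset.sum_congr rfl fun μ _ => (Algebra.smul_def _ _).symm
  have hrad : ∑ μ, J.X μ * (J.D μ (g : smoothFn R W) + β μ * g) = 0 := by
    refine Subtype.ext (funext fun z => (hX (ha' 0) z).trans ?_)
    exact ha.transport z (hWΩ z.2) y hy
  have hw := J.gauge_radial hrad
  have hrec : ∀ n : ℕ, ((n : ℝ) + 1) • restr (fun z => a (n + 1) z y) (ha' (n + 1))
      + ∑ μ, J.X μ * (J.D μ (restr (fun z => a (n + 1) z y) (ha' (n + 1)))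
        + β μ * restr (fun z => a (n + 1) z y) (ha' (n + 1)))
      = ∑ μ, (J.D μ (J.D μ (restr (fun z => a n z y) (ha' n)) + β μ * restr (fun z => a n z y) (ha' n))
        + β μ * (J.D μ (restr (fun z => a n z y) (ha' n)) + β μ * restr (fun z => a n z y) (ha' n)))
        + restr v hv' * restr (fun z => a n z y) (ha' n) := by
    intro n
    refine Subtype.ext (funext fun z => ?_)
    have h := ha.recurrence (n + 1) n.succ_pos z (hWΩ z.2) y hy
    rw [laplaceOp, neg_sub, sub_neg_eq_add, add_comm (v z * _), Nat.cast_succ] at h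
    refine Eq.trans ?_ (h.trans ?_)
    · exact congrArg _ (hX (ha' (n + 1)) z)
    · simp only [hJ, hβ, ← restr_covD hW hyW hB' (ha' n),
        ← restr_covD hW hyW hB' (contDiffOn_covD hW hB' (ha' n) _)]
      exact congrArg (· + _) (by
        rw [AddSubmonoidClass.coe_finsetSum, Finset.sum_apply]
        rfl)
  -- Gauge covariance conjugates by g, and g is 1 at y.
  have hF : ∀ c α, nablasF B c α y = J.ev (J.nabsF (J.gauge β g) c α) := by
    intro c α
    obtain ⟨h, e⟩ := restr_nablasF hW hyW hB' c α
    rw [J.nabsF_gauge, map_mul, map_mul, hg1, hg1', one_mul, mul_one, hJ, hβ, ← e]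
    rfl
  have hN : ∀ α, nablas B v α y
      = J.ev (J.nabs (J.gauge β g) (↑g⁻¹ * restr v hv' * g) α) := by
    intro α
    obtain ⟨h, e⟩ := restr_nablas hW hyW hB' hv' α
    rw [J.nabs_gauge, map_mul, map_mul, hg1, hg1', one_mul, mul_one, hJ, hβ, ← e]
    rfl
  rw [diagFormula_eq_familySum B v n y fun _ => 0,
    J.familySum_eq_ev (w := J.gauge β g) (f := ↑g⁻¹ * restr v hv' * g)
      (b := fun n => ↑g⁻¹ * restr (fun z => a n z y) (ha' n)) g.inv_mul
      (fun n => J.heat_recurrence_gauge hrad (hrec n)) rfl ?_ ?_ n le_rfl _ (by simp)]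
  -- With exactly 2n labels no derivative is left over, and the value is b_n(y) = a_n(y,y).
  · have : (Finset.univ : Finset (Fin (2 * n))).filter (fun q : Fin (2 * n) => 2 * n ≤ (q : ℕ))
        = ∅ := by
      ext q
      simp
    rw [this, JetAlgebra.labelD, labelList_empty, List.map_nil, JetAlgebra.iterD_nil, map_mul,
      hg1', one_mul]
    rfl
  · intro n c l hl
    rw [omega_cons_eq B v n c l hl, J.omegaOff_eq hw hF, J.iterD_perm (List.reverse_perm _)]
  · intro n c c' l
    rw [omega_pair_eq, J.omegaDiag_eq hw hN hF, J.iterD_perm (List.reverse_perm _)]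

end Main

end SeeleyDeWitt

theorem mainTheorem1 {𝕜 : Type*} [RCLike 𝕜] (d : ℕ) [NeZero d] (m : ℕ)
    (Ω : Set (Eucl d)) (hΩ : IsOpen Ω) (hΩc : Convex ℝ Ω)
    (B : Fin d → Eucl d → Matrix (Fin m) (Fin m) 𝕜) (hB : ∀ μ, ContDiffOn ℝ ∞ (B μ) Ω)
    (v : Eucl d → Matrix (Fin m) (Fin m) 𝕜) (hv : ContDiffOn ℝ ∞ v Ω)
    (a : ℕ → Eucl d → Eucl d → Matrix (Fin m) (Fin m) 𝕜)
    (ha : SeeleyDeWitt.IsHeatCoeff Ω B v a)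
    (n : ℕ) (x : Eucl d) (hx : x ∈ Ω) :
    a n x x = SeeleyDeWitt.diagFormula B v n x := by
  -- Completeness makes the units open and inversion smooth.
  have : CompleteSpace (Matrix (Fin m) (Fin m) 𝕜) := FiniteDimensional.complete ℝ _
  exact ha.diag_eq hΩ hB hv n hx
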